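/- Let $\lambda = (\lambda_1^{a_1}, \lambda_2^{a_2}, \ldots, \lambda_m^{a_m})$ be an integer partition written in weakly increasing order, where $m \ge 1$, $0 < \lambda_1 < \cdots < \lambda_m$ are integers, and $\lambda_i$ is repeated $a_i > 0$ times (for example $\lambda = (1^{a_1}, \ldots, m^{a_m})$). Put $n = a_1 + \cdots + a_m$ and let $\ell_1 \le \cdots \le \ell_n$ be the parts of $\lambda$ listed with multiplicity. The Gelfand–Tsetlin polytope $\mathrm{GT}_\lambda$ is the set of real triangular arrays $(x_{i,j})_{1 \le j \le i \le n}$ with $x_{i,i} = \ell_i$ for all $i$, and with $x_{i-1,j} \le x_{i,j}$ and $x_{i,j-1} \le x_{i,j}$ whenever both entries exist. Its 1-skeleton is the graph whose vertices and edges are the $0$- and $1$-dimensional faces of $\mathrm{GT}_\lambda$. Assume that $(a_1,\ldots,a_m)$ is neither $(1)$ nor $(1,1)$. Then the 1-skeleton of $\mathrm{GT}_\lambda$ is connected, and its graph diameter (the maximum over all pairs of vertices of the number of edges in a shortest path between them) is finite and equals $$2m - 2 - \delta_{1,a_1} - \delta_{1,a_m},$$ where $\delta_{x,y} = 1$ if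 $x = y$ and $\delta_{x,y} = 0$ otherwise. -/

import Mathlib

/-- The 1-skeleton of a polytope `P`: its vertices are the points `v` for which `{v}` is a face
of `P`, and two distinct vertices are joined by an edge iff they lie on a common
one-dimensional face of `P`. Faces are the sets of maximizers over `P` of linear functionals. -/
def oneSkeleton {E : Type*} [AddCommGroup E] [Module ℝ E] [TopologicalSpace E] (P : Set E) :
    SimpleGraph {v : E // IsExposed ℝ P {v}} where
  Adj u v := u ≠ v ∧ ∃ F : Set E, IsExposed ℝ P F ∧
    Module.finrank ℝ (vectorSpan ℝ F) = 1 ∧ (u : E) ∈ F ∧ (v : E) ∈ F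
  symm := ⟨fun _ _ ⟨hne, F, hF, hd, hu, hv⟩ => ⟨hne.symm, F, hF, hd, hv, hu⟩⟩
  loopless := ⟨fun _ h => h.1 rfl⟩

/-- The triangular index set: pairs (row, column) with column ≤ row. -/
abbrev TriangleIndex (n : ℕ) : Type := {p : Fin n × Fin n // p.2 ≤ p.1}

/-- The Gelfand–Tsetlin polytope of `lam`: triangular arrays with diagonal `lam` whose columns
(downwards) and rows (to the right) are weakly increasing. -/
def gtPolytope {n : ℕ} (lam : Fin n → ℕ) : Set (TriangleIndex n → ℝ) :=
  {x | (∀ i : Fin n, x ⟨(i, i), le_refl i⟩ = lam i) ∧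
    (∀ p q : TriangleIndex n, (q.1.1 : ℕ) = p.1.1 + 1 → q.1.2 = p.1.2 → x p ≤ x q) ∧
    (∀ p q : TriangleIndex n, q.1.1 = p.1.1 → (q.1.2 : ℕ) = p.1.2 + 1 → x p ≤ x q)}

/-- The sequence `(c 0, …, c 0, c 1, …, c 1, …)` in which `c i` is repeated `a i` times;
`finSigmaFinEquiv` enumerates the pairs `(i, k)` with `k < a i` lexicographically. -/
def blockSeq {m : ℕ} (c a : Fin m → ℕ) : Fin (∑ i, a i) → ℕ :=
  fun k => c (finSigmaFinEquiv.symm k).1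

/-!
The Gelfand–Tsetlin polytope is the marked order polytope of a triangular poset whose diagonal is
marked. The smallest face containing a point records along which covering relations the point is
constant. Hence the vertices are the arrays in which every connected piece of every level set meets
the diagonal, and two vertices are adjacent iff the entries at which they differ form a connected
piece on which both are constant. In particular only the positions of the jumps of the diagonal
matter, and its values may be replaced by the levels `0, …, L`, where `L = m - 1`.

Upper bound: one flip pushes all entries of a level that can be pushed down to lower levels. Doing
this level by level from the top brings any two vertices to a common one, with one flip per level
for each of them. If the last part is simple, then the entries of the top level lie in the last
row, so at that level the two vertices differ along a chain and one flip is enough; if the first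
part is simple, the same happens in the first column.

Lower bound: consider a walk from `ℓ ⌊(i + j) / 2⌋` to `ℓ ⌈(i + j) / 2⌉`. Identifying the levels
`k, …, k + d` turns it into a walk of the same kind with `d` fewer levels, on which the moves inside
this range become idle. By induction it suffices to find a range in which at least `2 d` moves take
place, or a single move if it ends in a simple first or last part. Were there none, each pair of
consecutive levels would be exchanged at one time only, and following the entries close to a place
where an entry drops from `2` to `0` shows that a move between `0` and `2` or between `1` and `3`
happens twice, so that the levels `0, 1, 2` or `1, 2, 3` account for four moves after all.
-/

namespace GelfandTsetlin

section HasseOn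

variable {P : Type*} [Preorder P]

/-- The Hasse diagram of `P` with all edges outside `S` removed; its reachability relation says
that two elements lie in the same connected piece of `S`. -/
def hasseOn (S : Set P) : SimpleGraph P :=
  ((SimpleGraph.hasse P).induce S).spanningCoe

theorem hasseOn_adj {S : Set P} {p q : P} :
    (hasseOn S).Adj p q ↔ (p ⋖ q ∨ q ⋖ p) ∧ p ∈ S ∧ q ∈ S := by
  simp [hasseOn]

theorem hasseOn_mono {S T : Set P} (h : S ⊆ T) : hasseOn S ≤ hasseOn T := fun _ _ hpq => by
  rw [hasseOn_adj] at hpq ⊢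
  exact ⟨hpq.1, h hpq.2.1, h hpq.2.2⟩

theorem mem_of_reachable {S : Set P} {p q : P} (h : (hasseOn S).Reachable p q) (hp : p ∈ S) :
    q ∈ S := by
  rw [SimpleGraph.reachable_iff_reflTransGen] at h
  cases h with
  | refl => exact hp
  | tail _ h => exact (hasseOn_adj.1 h).2.2

theorem apply_eq_of_reachable {α : Type*} {x : P → α} {a : α} {p q : P}
    (h : (hasseOn {r | x r = a}).Reachable p q) (hp : x p = a) : x q = a :=
  mem_of_reachable (S := {r | x r = a}) h hp

theorem apply_eq_of_forall_covBy {α : Type*} {S : Set P} {p q : P}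
    (h : (hasseOn S).Reachable p q) {y : P → α}
    (hy : ∀ r s, r ⋖ s → r ∈ S → s ∈ S → y r = y s) : y p = y q := by
  rw [SimpleGraph.reachable_iff_reflTransGen] at h
  induction h with
  | refl => rfl
  | tail _ h ih =>
    obtain ⟨h | h, hr, hs⟩ := hasseOn_adj.1 h
    · exact ih.trans (hy _ _ h hr hs)
    · exact ih.trans (hy _ _ h hs hr).symm

end HasseOn

section Fillings

variable {P ι α : Type*} [Preorder P]

/-- The edges of the marked order polytope, described combinatorially: `x` and `y` differ on a
connected piece of the poset, on which both are constant. -/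
structure IsFlip (x y : P → α) : Prop where
  const : ∀ p q, x p ≠ y p → x q ≠ y q → x p = x q ∧ y p = y q
  reachable : ∀ p q, x p ≠ y p → x q ≠ y q → (hasseOn {r | x r ≠ y r}).Reachable p q

theorem IsFlip.symm {x y : P → α} (h : IsFlip x y) : IsFlip y x where
  const p q hp hq := (h.const p q hp.symm hq.symm).symm
  reachable p q hp hq :=
    (h.reachable p q hp.symm hq.symm).mono (hasseOn_mono fun _ hr => Ne.symm hr)

theorem IsFlip.exists_covBy_ne {x y : P → α} (h : IsFlip x y) {p q : P} (hpq : p ≠ q)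
    (hp : x p ≠ y p) (hq : x q ≠ y q) : ∃ r, (p ⋖ r ∨ r ⋖ p) ∧ x r ≠ y r := by
  obtain ⟨r, hr⟩ := (h.reachable p q hp hq).nonempty_neighborSet_left hpq
  exact ⟨r, (hasseOn_adj.1 hr).1, (hasseOn_adj.1 hr).2.2⟩

variable [Preorder α]

/-- Fillings of a marked poset: order-preserving maps that take the prescribed value `c i` at the
marked element `mark i`. -/
structure IsFilling (mark : ι → P) (c : ι → α) (x : P → α) : Prop where
  monotone : Monotone x
  apply_mark : ∀ i, x (mark i) = c i

/-- The vertices of the marked order polytope, described combinatorially: every connected piece of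
a level set contains a marked element. -/
structure IsVertexFilling (mark : ι → P) (c : ι → α) (x : P → α) : Prop
    extends IsFilling mark c x where
  exists_reachable : ∀ p, ∃ i, (hasseOn {q | x q = x p}).Reachable p (mark i)

theorem IsFlip.exists_reachable_mark {mark : ι → P} {c : ι → α} {x y : P → α}
    (hx : IsVertexFilling mark c x) (hy : IsVertexFilling mark c y) (h : IsFlip x y) {p : P}
    (hp : x p = y p) : ∃ i, (hasseOn {q | x q = x p ∧ y q = y p}).Reachable p (mark i) := by
  by_cases hxp : ∃ q, x q ≠ y q ∧ x q = x p
  · obtain ⟨q, hq, hqp⟩ := hxp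
    refine (hy.exists_reachable p).imp fun i hi => hi.mono (hasseOn_mono fun r hr => ⟨?_, hr⟩)
    by_contra hne
    exact hne ((h.const r q (fun hr' => hne ((hr'.trans hr).trans hp.symm)) hq).1.trans hqp)
  · push Not at hxp
    refine (hx.exists_reachable p).imp fun i hi => hi.mono (hasseOn_mono fun r hr => ⟨hr, ?_⟩)
    by_contra hne
    exact hxp r (fun hr' => hne (hr'.symm.trans (Eq.trans hr hp))) hr

/-- The combinatorial model of the 1-skeleton of a marked order polytope; since it only depends on
the order of the prescribed values, these may lie in any type. -/
def flipGraph (mark : ι → P) (c : ι → α) : SimpleGraph {x : P → α // IsVertexFilling mark c x} where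
  Adj u v := u ≠ v ∧ IsFlip u.1 v.1
  symm := ⟨fun _ _ h => ⟨h.1.symm, h.2.symm⟩⟩
  loopless := ⟨fun _ h => h.1 rfl⟩

theorem edist_le_one_of_isFlip {mark : ι → P} {c : ι → α} {x y : P → α}
    (hx : IsVertexFilling mark c x) (hy : IsVertexFilling mark c y) (h : IsFlip x y) :
    (flipGraph mark c).edist ⟨x, hx⟩ ⟨y, hy⟩ ≤ 1 := by
  rw [SimpleGraph.edist_le_one_iff_adj_or_eq]
  by_cases hxy : x = y
  · exact .inr (Subtype.ext hxy)
  · exact .inl ⟨fun he => hxy (congrArg Subtype.val he), h⟩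

end Fillings

section Polytope

variable {P ι : Type*} [PartialOrder P] {mark : ι → P} {c : ι → ℝ}

variable (mark c) in
/-- The marked order polytope of Ardila, Bliem and Salazar. -/
def markedOrderPolytope : Set (P → ℝ) :=
  {x | IsFilling mark c x}

theorem convex_markedOrderPolytope (mark : ι → P) (c : ι → ℝ) :
    Convex ℝ (markedOrderPolytope mark c) := by
  intro x hx y hy s t hs ht hst
  refine ⟨(hx.monotone.const_smul hs).add (hy.monotone.const_smul ht), fun i => ?_⟩
  simp only [Pi.add_apply, Pi.smul_apply, smul_eq_mul, hx.apply_mark, hy.apply_mark, ← add_mul,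
    hst, one_mul]

theorem isExposed_setOf_apply_eq {p q : P} (hpq : p ≤ q) :
    IsExposed ℝ (markedOrderPolytope mark c) {y ∈ markedOrderPolytope mark c | y p = y q} := by
  rintro ⟨z, hz, hzpq⟩
  refine ⟨.proj (φ := fun _ => ℝ) p - .proj q, Set.ext fun y => ?_⟩
  refine and_congr_right fun hy => ⟨fun h x hx => ?_, fun h => ?_⟩
  · simpa [h] using hx.monotone hpq
  · have := h z hz
    simp only [sub_apply, ContinuousLinearMap.proj_apply, hzpq, sub_self,
      sub_nonneg] at this
    exact le_antisymm (hy.monotone hpq) this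

/-- The set of fillings that take equal values along all covering pairs in `T`. -/
def tightFace (mark : ι → P) (c : ι → ℝ) (T : P → P → Prop) : Set (P → ℝ) :=
  {y ∈ markedOrderPolytope mark c | ∀ p q, p ⋖ q → T p q → y p = y q}

theorem IsFlip.collinear_tightFace {u v : P → ℝ} (hu : IsVertexFilling mark c u)
    (hv : IsVertexFilling mark c v) (h : IsFlip u v) {p₀ : P} (hp₀ : u p₀ ≠ v p₀) :
    Collinear ℝ (tightFace mark c fun p q => u p = u q ∧ v p = v q) := by
  have huF : u ∈ tightFace mark c fun p q => u p = u q ∧ v p = v q :=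
    ⟨hu.toIsFilling, fun _ _ _ h => h.1⟩
  refine (collinear_iff_of_mem huF).2
    ⟨Set.indicator {p | u p ≠ v p} 1, fun y hy => ⟨y p₀ - u p₀, funext fun p => ?_⟩⟩
  by_cases hp : u p = v p
  · obtain ⟨i, hi⟩ := h.exists_reachable_mark hu hv hp
    have hpi : ∀ z ∈ tightFace mark c (fun p q => u p = u q ∧ v p = v q), z p = c i :=
      fun z hz => (apply_eq_of_forall_covBy hi fun r s hrs hr hs =>
        hz.2 r s hrs ⟨hr.1.trans hs.1.symm, hr.2.trans hs.2.symm⟩).trans (hz.1.apply_mark i)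
    simp [hp, hpi y hy, ← hpi u huF]
  · have hpp₀ : ∀ z ∈ tightFace mark c (fun p q => u p = u q ∧ v p = v q), z p = z p₀ :=
      fun z hz => apply_eq_of_forall_covBy (h.reachable p p₀ hp hp₀) fun r s hrs hr hs =>
        hz.2 r s hrs (h.const r s hr hs)
    simp [Set.indicator_of_mem (show p ∈ {p | u p ≠ v p} from hp), hpp₀ y hy, hpp₀ u huF]

variable [Finite P]

theorem isExposed_tightFace (T : P → P → Prop) :
    IsExposed ℝ (markedOrderPolytope mark c) (tightFace mark c T) := by
  suffices h : ∀ E : Set (P × P), (∀ e ∈ E, e.1 ≤ e.2) →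
      IsExposed ℝ (markedOrderPolytope mark c)
        {y ∈ markedOrderPolytope mark c | ∀ e ∈ E, y e.1 = y e.2} by
    convert h {e | e.1 ⋖ e.2 ∧ T e.1 e.2} fun e he => he.1.le using 1
    simp [tightFace]
  intro E hE
  induction E, E.toFinite using Set.Finite.induction_on with
  | empty => simpa using IsExposed.refl _
  | @insert e E _ _ ih =>
    rw [Set.forall_mem_insert] at hE
    simp only [Set.forall_mem_insert, Set.sep_and]
    exact (isExposed_setOf_apply_eq hE.1).inter (ih hE.2)

theorem eventually_add_smul_indicator_mem {z : P → ℝ} (hz : z ∈ markedOrderPolytope mark c)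
    {C : Set P} (hmark : ∀ i, mark i ∉ C)
    (hC : ∀ p q, p ⋖ q → z p = z q → (p ∈ C ↔ q ∈ C)) :
    ∀ᶠ ε : ℝ in nhds 0, z + ε • C.indicator 1 ∈ markedOrderPolytope mark c := by
  classical
  cases nonempty_fintype P
  let _ := Fintype.toLocallyFiniteOrder (α := P)
  have hcont : ∀ p, Continuous fun ε : ℝ => (z + ε • C.indicator (1 : P → ℝ)) p := fun p => by
    simp only [Pi.add_apply, Pi.smul_apply]
    fun_prop
  have hcov : ∀ᶠ ε : ℝ in nhds 0, ∀ p q, p ⋖ q →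
      (z + ε • C.indicator (1 : P → ℝ)) p ≤ (z + ε • C.indicator (1 : P → ℝ)) q := by
    simp only [Filter.eventually_all]
    intro p q hpq
    rcases (hz.monotone hpq.le).eq_or_lt with h | h
    · refine .of_forall fun ε => le_of_eq ?_
      simp only [Pi.add_apply, Pi.smul_apply, h, Set.indicator_apply, hC p q hpq h, Pi.one_apply]
    · have h0 : (z + (0 : ℝ) • C.indicator (1 : P → ℝ)) p <
          (z + (0 : ℝ) • C.indicator (1 : P → ℝ)) q := by simpa using h
      exact ((hcont p).continuousAt.eventually_lt (hcont q).continuousAt h0).mono fun _ => le_of_lt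
  filter_upwards [hcov] with ε hε
  refine ⟨(monotone_iff_forall_covBy _).2 hε, fun i => ?_⟩
  simp [hmark i, hz.apply_mark]

theorem indicator_mem_vectorSpan {F : Set (P → ℝ)}
    (hF : IsExposed ℝ (markedOrderPolytope mark c) F) {z : P → ℝ} (hz : z ∈ F) {C : Set P}
    (hmark : ∀ i, mark i ∉ C) (hC : ∀ p q, p ⋖ q → z p = z q → (p ∈ C ↔ q ∈ C)) :
    C.indicator 1 ∈ vectorSpan ℝ F := by
  obtain ⟨δ, hδ, hball⟩ := Metric.eventually_nhds_iff.1
    (eventually_add_smul_indicator_mem (hF.subset hz) hmark hC)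
  have hplus := hball (y := δ / 2) (by simp [abs_of_pos hδ, hδ])
  have hminus := hball (y := -(δ / 2)) (by simp [abs_of_pos hδ, hδ])
  have hmem : z + (δ / 2) • C.indicator 1 ∈ F := by
    obtain ⟨l, rfl⟩ := hF ⟨z, hz⟩
    refine ⟨hplus, fun y hy => ?_⟩
    have h1 := hz.2 y hy
    have h2 := hz.2 _ hminus
    simp only [map_add, map_smul, smul_eq_mul] at h2 ⊢
    linarith
  have h := vsub_mem_vectorSpan ℝ hmem hz
  rwa [vsub_eq_sub, add_sub_cancel_left, Submodule.smul_mem_iff _ (by positivity)] at h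

theorem isVertexFilling_of_isExposed {v : P → ℝ}
    (hv : IsExposed ℝ (markedOrderPolytope mark c) {v}) : IsVertexFilling mark c v where
  toIsFilling := hv.subset rfl
  exists_reachable p := by
    by_contra! hcon
    have h := indicator_mem_vectorSpan hv rfl (C := {q | (hasseOn {q | v q = v p}).Reachable p q})
      hcon fun q r hqr heq => by
        have hadj : v q = v p → (hasseOn {q | v q = v p}).Adj q r := fun hq =>
          hasseOn_adj.2 ⟨.inl hqr, hq, heq.symm.trans hq⟩
        exact ⟨fun hq => hq.trans (hadj (apply_eq_of_reachable hq rfl)).reachable,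
          fun hr => hr.trans (hadj (heq.trans (apply_eq_of_reachable hr rfl))).symm.reachable⟩
    rw [vectorSpan_singleton, Submodule.mem_bot] at h
    simpa using congrFun h p

theorem isExposed_of_isVertexFilling {v : P → ℝ} (hv : IsVertexFilling mark c v) :
    IsExposed ℝ (markedOrderPolytope mark c) {v} := by
  convert isExposed_tightFace (mark := mark) (c := c) fun p q => v p = v q using 1
  refine Set.ext fun y => ⟨?_, fun ⟨hy, hT⟩ => funext fun p => ?_⟩
  · rintro rfl
    exact ⟨hv.toIsFilling, fun _ _ _ h => h⟩
  · obtain ⟨i, hi⟩ := hv.exists_reachable p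
    calc
      y p = y (mark i) :=
        apply_eq_of_forall_covBy hi fun r s hrs hr hs => hT r s hrs (Eq.trans hr hs.symm)
      _ = v (mark i) := by rw [hy.apply_mark, hv.apply_mark]
      _ = v p := apply_eq_of_reachable hi rfl

theorem isExposed_singleton_iff {v : P → ℝ} :
    IsExposed ℝ (markedOrderPolytope mark c) {v} ↔ IsVertexFilling mark c v :=
  ⟨isVertexFilling_of_isExposed, isExposed_of_isVertexFilling⟩

theorem IsFlip.adj_oneSkeleton {u v : {v : P → ℝ // IsExposed ℝ (markedOrderPolytope mark c) {v}}}
    (h : IsFlip u.1 v.1) (huv : u ≠ v) : (oneSkeleton (markedOrderPolytope mark c)).Adj u v := by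
  obtain ⟨p₀, hp₀⟩ := Function.ne_iff.1 (Subtype.coe_ne_coe.2 huv)
  have hu := isVertexFilling_of_isExposed u.2
  have hv := isVertexFilling_of_isExposed v.2
  have huF : u.1 ∈ tightFace mark c fun p q => u.1 p = u.1 q ∧ v.1 p = v.1 q :=
    ⟨hu.toIsFilling, fun _ _ _ h => h.1⟩
  have hvF : v.1 ∈ tightFace mark c fun p q => u.1 p = u.1 q ∧ v.1 p = v.1 q :=
    ⟨hv.toIsFilling, fun _ _ _ h => h.2⟩
  refine ⟨huv, _, isExposed_tightFace _, le_antisymm ?_ ?_, huF, hvF⟩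
  · exact collinear_iff_finrank_le_one.1 (h.collinear_tightFace hu hv hp₀)
  · exact Module.finrank_pos_iff_exists_ne_zero.2
      ⟨⟨u.1 - v.1, vsub_mem_vectorSpan ℝ huF hvF⟩, by
        simpa [sub_eq_zero, ← Subtype.ext_iff] using huv⟩

theorem indicator_component_mem_vectorSpan {F : Set (P → ℝ)}
    (hF : IsExposed ℝ (markedOrderPolytope mark c) F) {u v : P → ℝ} (hu : u ∈ F) (hv : v ∈ F)
    {p : P} (hp : u p ≠ v p) :
    Set.indicator {q | (hasseOn {r | u r = u p ∧ v r = v p}).Reachable p q} 1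
      ∈ vectorSpan ℝ F := by
  have hmid : midpoint ℝ u v ∈ F :=
    (hF.convex (convex_markedOrderPolytope mark c)).midpoint_mem hu hv
  replace hu : IsFilling mark c u := hF.subset hu
  replace hv : IsFilling mark c v := hF.subset hv
  set S := {r | u r = u p ∧ v r = v p}
  have hpS : p ∈ S := ⟨rfl, rfl⟩
  refine indicator_mem_vectorSpan hF hmid (fun i hi => hp ?_) fun r s hrs heq => ?_
  · obtain ⟨h1, h2⟩ := mem_of_reachable hi hpS
    rw [← h1, ← h2, hu.apply_mark, hv.apply_mark]
  · have hrs' : u r = u s ∧ v r = v s := by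
      have h1 := hu.monotone hrs.le
      have h2 := hv.monotone hrs.le
      simp only [midpoint_eq_smul_add, invOf_eq_inv, Pi.smul_apply, Pi.add_apply,
        smul_eq_mul] at heq
      constructor <;> linarith
    have hadj : r ∈ S ∨ s ∈ S → (hasseOn S).Adj r s := fun h =>
      hasseOn_adj.2 ⟨.inl hrs, by simpa [S, hrs'] using h⟩
    exact ⟨fun h => h.trans (hadj (.inl (mem_of_reachable h hpS))).reachable,
      fun h => h.trans (hadj (.inr (mem_of_reachable h hpS))).symm.reachable⟩

theorem reachable_of_finrank_eq_one {F : Set (P → ℝ)}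
    (hF : IsExposed ℝ (markedOrderPolytope mark c) F) (hdim : Module.finrank ℝ (vectorSpan ℝ F) = 1)
    {u v : P → ℝ} (hu : u ∈ F) (hv : v ∈ F) {p q : P} (hp : u p ≠ v p) (hq : u q ≠ v q) :
    (hasseOn {r | u r = u p ∧ v r = v p}).Reachable p q := by
  have hind := indicator_component_mem_vectorSpan hF hu hv hp
  set C := {q | (hasseOn {r | u r = u p ∧ v r = v p}).Reachable p q}
  have hpC : p ∈ C := SimpleGraph.Reachable.refl p
  have hne : (⟨u - v, vsub_mem_vectorSpan ℝ hu hv⟩ : vectorSpan ℝ F) ≠ 0 := fun h =>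
    hp (sub_eq_zero.1 (congrFun (congrArg Subtype.val h) p))
  obtain ⟨t, ht⟩ := (finrank_eq_one_iff_of_nonzero' _ hne).1 hdim ⟨_, hind⟩
  replace ht : ∀ r, t * (u r - v r) = C.indicator 1 r := congrFun (congrArg Subtype.val ht)
  have ht0 : t ≠ 0 := left_ne_zero_of_mul (by simp [ht, hpC] : t * (u p - v p) ≠ 0)
  suffices h : q ∈ C from h
  by_contra hqC
  have : t * (u q - v q) = 0 := by rw [ht, Set.indicator_of_notMem hqC]
  exact mul_ne_zero ht0 (sub_ne_zero.2 hq) this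

theorem isFlip_of_adj_oneSkeleton
    {u v : {v : P → ℝ // IsExposed ℝ (markedOrderPolytope mark c) {v}}}
    (h : (oneSkeleton (markedOrderPolytope mark c)).Adj u v) : IsFlip u.1 v.1 := by
  obtain ⟨-, F, hF, hdim, huF, hvF⟩ := h
  have hreach := fun p q => reachable_of_finrank_eq_one hF hdim huF hvF (p := p) (q := q)
  refine ⟨fun p q hp hq => ?_, fun p q hp hq => ?_⟩
  · exact mem_of_reachable (S := {r | u.1 r = u.1 q ∧ v.1 r = v.1 q}) (hreach q p hq hp) ⟨rfl, rfl⟩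
  · refine (hreach p q hp hq).mono (hasseOn_mono fun r hr => ?_)
    simpa [hr.1, hr.2] using hp

variable (mark c) in
/-- The combinatorial description of the 1-skeleton of a marked order polytope. -/
def skeletonIso : oneSkeleton (markedOrderPolytope mark c) ≃g flipGraph mark c where
  toEquiv := Equiv.subtypeEquivRight fun _ => isExposed_singleton_iff
  map_rel_iff' {u v} := by
    refine ⟨fun h => ?_, fun h => ⟨fun h' => ?_, isFlip_of_adj_oneSkeleton h⟩⟩
    · exact IsFlip.adj_oneSkeleton h.2 fun h' => h.1 (congrArg _ h')
    · exact h.1 (Equiv.injective _ h')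

end Polytope

section Relabel

variable {P ι α β : Type*} [Preorder P] {mark : ι → P} {c : ι → α}

theorem IsFlip.comp {x y : P → α} (h : IsFlip x y) (f : α → β) : IsFlip (f ∘ x) (f ∘ y) where
  const p q hp hq :=
    (h.const p q (mt (congrArg f) hp) (mt (congrArg f) hq)).imp (congrArg f) (congrArg f)
  reachable p q hp hq := by
    have hp' := mt (congrArg f) hp
    refine (h.reachable p q hp' (mt (congrArg f) hq)).mono (hasseOn_mono fun r hr => ?_)
    obtain ⟨hx, hy⟩ := h.const r p hr hp'
    simpa [hx, hy] using hp

theorem isFlip_comp_iff {f : α → β} (hf : Function.Injective f) {x y : P → α} :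
    IsFlip (f ∘ x) (f ∘ y) ↔ IsFlip x y := by
  have hne : ∀ p, (f ∘ x) p ≠ (f ∘ y) p ↔ x p ≠ y p := fun p => hf.ne_iff
  refine ⟨fun h => ⟨fun p q hp hq => ?_, ?_⟩, fun h => h.comp f⟩
  · exact (h.const p q ((hne p).2 hp) ((hne q).2 hq)).imp (@hf _ _) (@hf _ _)
  · simpa only [hne] using h.reachable

variable [Preorder α] [Preorder β]

theorem IsVertexFilling.comp {x : P → α} (h : IsVertexFilling mark c x) {f : α → β}
    (hf : Monotone f) : IsVertexFilling mark (f ∘ c) (f ∘ x) where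
  monotone := hf.comp h.monotone
  apply_mark i := congrArg f (h.apply_mark i)
  exists_reachable p :=
    (h.exists_reachable p).imp fun _ hi => hi.mono (hasseOn_mono fun _ hr => congrArg f hr)

theorem isVertexFilling_comp_iff (f : α ↪o β) {x : P → α} :
    IsVertexFilling mark (f ∘ c) (f ∘ x) ↔ IsVertexFilling mark c x := by
  refine ⟨fun h => ⟨⟨fun p q hpq => ?_, fun i => ?_⟩, ?_⟩, fun h => h.comp f.monotone⟩
  · exact f.le_iff_le.1 (h.monotone hpq)
  · exact f.injective (h.apply_mark i)
  · simpa using h.exists_reachable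

theorem IsVertexFilling.exists_eq {x : P → α} (hx : IsVertexFilling mark c x) (p : P) :
    ∃ i, x p = c i := by
  obtain ⟨i, hi⟩ := hx.exists_reachable p
  exact ⟨i, (apply_eq_of_reachable hi rfl).symm.trans (hx.apply_mark i)⟩

variable (mark c) in
/-- Relabelling the prescribed values by an order embedding does not change the flip graph. -/
noncomputable def relabelIso (f : α ↪o β) : flipGraph mark c ≃g flipGraph mark (f ∘ c) where
  toEquiv := Equiv.ofBijective
    (fun x => ⟨f ∘ x.1, (isVertexFilling_comp_iff f).2 x.2⟩)
    ⟨fun x y h => Subtype.ext (f.injective.comp_left (congrArg Subtype.val h)), fun y => by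
      choose i hi using y.2.exists_eq
      have hy : f ∘ (c ∘ i) = y.1 := funext fun p => (hi p).symm
      exact ⟨⟨c ∘ i, (isVertexFilling_comp_iff f).1 (hy ▸ y.2)⟩, Subtype.ext hy⟩⟩
  map_rel_iff' := and_congr (Equiv.injective _).ne_iff (isFlip_comp_iff f.injective)

end Relabel

section Distance

theorem edist_le_edist_apply {V W : Type*} {G : SimpleGraph V} {H : SimpleGraph W} (φ : G →g H)
    (u v : V) : H.edist (φ u) (φ v) ≤ G.edist u v := by
  refine le_iInf fun w => ?_
  simpa using SimpleGraph.edist_le (w.map φ)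

theorem ediam_le_ediam_of_iso {V W : Type*} {G : SimpleGraph V} {H : SimpleGraph W} (φ : G ≃g H) :
    H.ediam ≤ G.ediam := by
  refine SimpleGraph.ediam_le_of_edist_le fun u v => ?_
  obtain ⟨u, rfl⟩ := φ.surjective u
  obtain ⟨v, rfl⟩ := φ.surjective v
  exact (edist_le_edist_apply φ.toHom u v).trans SimpleGraph.edist_le_ediam

theorem ediam_eq_of_iso {V W : Type*} {G : SimpleGraph V} {H : SimpleGraph W} (φ : G ≃g H) :
    G.ediam = H.ediam :=
  le_antisymm (ediam_le_ediam_of_iso φ.symm) (ediam_le_ediam_of_iso φ)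

end Distance

section Recolor

variable {P α : Type*} {x : P → α} {C : Set P} {r p : P}

/-- The filling obtained from `x` by assigning the value `x r` to all elements of `C`. -/
noncomputable def recolor (x : P → α) (C : Set P) (r : P) : P → α :=
  open scoped Classical in fun p => if p ∈ C then x r else x p

theorem recolor_of_mem (hp : p ∈ C) : recolor x C r p = x r := if_pos hp

theorem recolor_of_notMem (hp : p ∉ C) : recolor x C r p = x p := if_neg hp

end Recolor

section Lowering

variable {P ι α : Type*} [PartialOrder P]

theorem exists_reachable_covBy_notMem {S C : Set P} {p q : P} (h : (hasseOn S).Reachable p q)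
    (hp : p ∈ C) (hq : q ∉ C) :
    ∃ r ∈ C, (hasseOn C).Reachable p r ∧ ∃ s ∉ C, s ∈ S ∧ (r ⋖ s ∨ s ⋖ r) := by
  rw [SimpleGraph.reachable_iff_reflTransGen] at h
  induction h using Relation.ReflTransGen.head_induction_on with
  | refl => exact absurd hp hq
  | @head p s hps _ ih =>
    obtain ⟨hcov, -, hs⟩ := hasseOn_adj.1 hps
    by_cases hsC : s ∈ C
    · obtain ⟨r, hr, hsr, h⟩ := ih hsC
      exact ⟨r, hr, .trans (hasseOn_adj.2 ⟨hcov, hp, hsC⟩ : (hasseOn C).Adj p s).reachable hsr, h⟩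
    · exact ⟨p, hp, .refl p, s, hsC, hs, hcov⟩

/-- The pieces `C` of the level set of `x` at height `θ` that a single flip can push down: `C` is
connected, contains no mark, lies at the bottom of the level set, and the rest of the level set
stays connected to the marks. -/
structure IsLowerable (mark : ι → P) (x : P → α) (θ : α) (C : Set P) : Prop where
  apply_eq : ∀ p ∈ C, x p = θ
  mark_notMem : ∀ i, mark i ∉ C
  mem_of_covBy : ∀ p q, p ⋖ q → x p = θ → q ∈ C → p ∈ C
  reachable : ∀ p ∈ C, ∀ q ∈ C, (hasseOn C).Reachable p q
  exists_reachable : ∀ p ∉ C, x p = θ → ∃ i, (hasseOn {q | x q = θ ∧ q ∉ C}).Reachable p (mark i)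

theorem IsLowerable.isFlip_recolor {mark : ι → P} {x : P → α} {θ : α} {C : Set P}
    (hC : IsLowerable mark x θ C) {r : P} (hr : x r ≠ θ) :
    IsFlip x (recolor x C r) := by
  have hne : ∀ p, x p ≠ recolor x C r p ↔ p ∈ C := fun p => by
    by_cases hp : p ∈ C
    · simp only [recolor_of_mem hp, hC.apply_eq p hp, ne_eq, hr.symm, not_false_eq_true, hp]
    · simp only [recolor_of_notMem hp, ne_eq, not_true_eq_false, hp]
  refine ⟨fun p q hp hq => ?_, fun p q hp hq => ?_⟩
  · rw [hne] at hp hq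
    exact ⟨(hC.apply_eq p hp).trans (hC.apply_eq q hq).symm,
      (recolor_of_mem hp).trans (recolor_of_mem hq).symm⟩
  · simpa only [hne, Set.ofPred_mem_eq] using hC.reachable p ((hne p).1 hp) q ((hne q).1 hq)

variable [Finite P]

theorem reachable_of_Icc_subset {S : Set P} {p q : P} (hpq : p ≤ q) (hS : Set.Icc p q ⊆ S) :
    (hasseOn S).Reachable p q := by
  have := Fintype.ofFinite P
  classical
  let _ : LocallyFiniteOrder P := Fintype.toLocallyFiniteOrder
  have h := le_iff_reflTransGen_covBy.1 hpq
  induction h using Relation.ReflTransGen.head_induction_on with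
  | refl => exact .refl _
  | @head p r hpr h ih =>
    have hrq := le_iff_reflTransGen_covBy.2 h
    refine .trans (SimpleGraph.Adj.reachable (hasseOn_adj.2 ⟨.inl hpr, ?_, ?_⟩))
      (ih hrq fun s hs => hS ⟨hpr.le.trans hs.1, hs.2⟩)
    · exact hS ⟨le_rfl, hpq⟩
    · exact hS ⟨hpr.le, hrq⟩

theorem reachable_of_isChain {S : Set P} (hS : IsChain (· ≤ ·) S) (hS' : S.OrdConnected) {p q : P}
    (hp : p ∈ S) (hq : q ∈ S) : (hasseOn S).Reachable p q := by
  rcases hS.total hp hq with h | h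
  · exact reachable_of_Icc_subset h (hS'.out hp hq)
  · exact (reachable_of_Icc_subset h (hS'.out hq hp)).symm

variable [LinearOrder α] {mark : ι → P} {c : ι → α} {x y : P → α} {θ : α} {C : Set P}

theorem IsLowerable.exists_maximal_below (hC : IsLowerable mark x θ C) (hne : C.Nonempty)
    (hmin : ∀ p, IsMin p → ∃ i, mark i = p) :
    ∃ r ∉ C, (∃ q ∈ C, r ⋖ q) ∧ ∀ p ∉ C, ∀ q ∈ C, p ⋖ q → x p ≤ x r := by
  have hB : {p | p ∉ C ∧ ∃ q ∈ C, p ⋖ q}.Nonempty := by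
    obtain ⟨q, hq⟩ := C.toFinite.exists_minimal hne
    have hqmin : ¬IsMin q := fun h => by
      obtain ⟨i, hi⟩ := hmin q h
      exact hC.mark_notMem i (hi ▸ hq.prop)
    obtain ⟨p, hpq⟩ := exists_covBy_of_wellFoundedGT hqmin
    exact ⟨p, fun hp => hq.not_lt hp hpq.lt, q, hq.prop, hpq⟩
  obtain ⟨r, ⟨hr, hrq⟩, hmax⟩ := Set.exists_max_image _ x (Set.toFinite _) hB
  exact ⟨r, hr, hrq, fun p hp q hq hpq => hmax p ⟨hp, q, hq, hpq⟩⟩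

theorem IsLowerable.monotone_recolor (hC : IsLowerable mark x θ C) (hx : Monotone x) {r : P}
    (hr : x r < θ) (hmax : ∀ p ∉ C, ∀ q ∈ C, p ⋖ q → x p ≤ x r) : Monotone (recolor x C r) := by
  have := Fintype.ofFinite P
  classical
  let _ : LocallyFiniteOrder P := Fintype.toLocallyFiniteOrder
  refine (monotone_iff_forall_covBy _).2 fun p q hpq => ?_
  by_cases hp : p ∈ C <;> by_cases hq : q ∈ C
  · rw [recolor_of_mem hp, recolor_of_mem hq]
  · rw [recolor_of_mem hp, recolor_of_notMem hq]
    exact hr.le.trans ((hC.apply_eq p hp).symm.le.trans (hx hpq.le))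
  · rw [recolor_of_notMem hp, recolor_of_mem hq]
    exact hmax p hp q hq hpq
  · rw [recolor_of_notMem hp, recolor_of_notMem hq]
    exact hx hpq.le

theorem IsLowerable.isVertexFilling_recolor (hC : IsLowerable mark x θ C)
    (hx : IsVertexFilling mark c x) {q r : P} (hq : q ∈ C) (hr : r ∉ C) (hrq : r ⋖ q)
    (hrθ : x r < θ) (hmax : ∀ p ∉ C, ∀ q ∈ C, p ⋖ q → x p ≤ x r) :
    IsVertexFilling mark c (recolor x C r) := by
  refine ⟨⟨hC.monotone_recolor hx.monotone hrθ hmax, fun i => ?_⟩, fun p => ?_⟩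
  · rw [recolor_of_notMem (hC.mark_notMem i), hx.apply_mark]
  have hlevel : ∀ p, x p ≠ θ → ∃ i, (hasseOn {q | recolor x C r q = x p}).Reachable p (mark i) :=
    fun p hp => (hx.exists_reachable p).imp fun i hi => hi.mono (hasseOn_mono fun q hqp =>
      (recolor_of_notMem fun h => hp (hqp.symm.trans (hC.apply_eq q h))).trans hqp)
  by_cases hp : p ∈ C
  · obtain ⟨i, hi⟩ := hlevel r hrθ.ne
    rw [recolor_of_mem hp]
    have hpq := (hC.reachable p hp q hq).mono
      (hasseOn_mono fun s hs => recolor_of_mem (x := x) (r := r) hs)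
    have hqr : (hasseOn {s | recolor x C r s = x r}).Adj q r :=
      hasseOn_adj.2 ⟨.inr hrq, recolor_of_mem hq, recolor_of_notMem hr⟩
    exact ⟨i, hpq.trans (hqr.reachable.trans hi)⟩
  · rw [recolor_of_notMem hp]
    by_cases hpθ : x p = θ
    · exact (hC.exists_reachable p hp hpθ).imp fun i hi => hi.mono (hasseOn_mono fun s hs =>
        (recolor_of_notMem hs.2).trans (hs.1.trans hpθ.symm))
    · exact hlevel p hpθ

theorem IsLowerable.exists_isFlip (hC : IsLowerable mark x θ C) (hx : IsVertexFilling mark c x)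
    (hmin : ∀ p, IsMin p → ∃ i, mark i = p) :
    ∃ y, IsVertexFilling mark c y ∧ IsFlip x y ∧ (∀ p ∈ C, y p < θ) ∧ ∀ p ∉ C, y p = x p := by
  obtain rfl | hne := C.eq_empty_or_nonempty
  · exact ⟨x, hx, ⟨fun _ _ h => absurd rfl h, fun _ _ h => absurd rfl h⟩,
      fun _ h => absurd h (Set.notMem_empty _), fun _ _ => rfl⟩
  obtain ⟨r, hr, ⟨q, hq, hrq⟩, hmax⟩ := hC.exists_maximal_below hne hmin
  have hrθ : x r < θ := lt_of_le_of_ne ((hx.monotone hrq.le).trans_eq (hC.apply_eq q hq))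
    fun h => hr (hC.mem_of_covBy r q hrq h hq)
  exact ⟨recolor x C r, hC.isVertexFilling_recolor hx hq hr hrq hrθ hmax, hC.isFlip_recolor hrθ.ne,
    fun p hp => (recolor_of_mem hp).trans_lt hrθ, fun p => recolor_of_notMem⟩

/-- Here the part of the top level of `x` outside the top level of `y` is pushed down. -/
theorem IsVertexFilling.exists_isFlip_of_top (hx : IsVertexFilling mark c x)
    (hy : IsVertexFilling mark c y) (hmin : ∀ p, IsMin p → ∃ i, mark i = p)
    (hxθ : ∀ p, x p ≤ θ) (hyθ : ∀ p, y p ≤ θ) (hchain : IsChain (· ≤ ·) {p | x p = θ})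
    (hxy : ∀ p, y p = θ → x p = θ) :
    ∃ z, IsVertexFilling mark c z ∧ IsFlip x z ∧ ∀ p, z p = θ ↔ y p = θ := by
  have hup : ∀ p q, p ≤ q → y p = θ → y q = θ := fun p q hpq h =>
    le_antisymm (hyθ q) (h ▸ hy.monotone hpq)
  have hconvex : Set.OrdConnected {p | x p = θ ∧ y p ≠ θ} := ⟨fun p hp q hq r hr =>
    ⟨le_antisymm (hxθ r) (hp.1 ▸ hx.monotone hr.1), fun h => hq.2 (hup r q hr.2 h)⟩⟩
  have hC : IsLowerable mark x θ {p | x p = θ ∧ y p ≠ θ} := by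
    refine ⟨fun p hp => hp.1, fun i hi => hi.2 ?_, fun p q hpq hp hq => ⟨hp, fun h => hq.2 ?_⟩,
      fun p hp q hq => reachable_of_isChain (hchain.mono fun p hp => hp.1) hconvex hp hq,
      fun p hp hpθ => ?_⟩
    · rw [hy.apply_mark, ← hx.apply_mark, hi.1]
    · exact hup p q hpq.le h
    · have hyp : y p = θ := by_contra fun h => hp ⟨hpθ, h⟩
      refine (hy.exists_reachable p).imp fun i hi => hi.mono (hasseOn_mono fun q hq => ?_)
      have hyq : y q = θ := Eq.trans hq hyp
      exact ⟨hxy q hyq, fun h => h.2 hyq⟩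
  obtain ⟨z, hz, hxz, hzC, hzC'⟩ := hC.exists_isFlip hx hmin
  refine ⟨z, hz, hxz, fun p => ?_⟩
  by_cases hp : p ∈ {p | x p = θ ∧ y p ≠ θ}
  · exact iff_of_false (hzC p hp).ne hp.2
  · rw [hzC' p hp]
    exact ⟨fun h => by_contra fun h' => hp ⟨h, h'⟩, hxy p⟩

theorem exists_edist_le_of_top {u v : {x : P → α // IsVertexFilling mark c x}}
    (hmin : ∀ p, IsMin p → ∃ i, mark i = p) (hu : ∀ p, u.1 p ≤ θ) (hv : ∀ p, v.1 p ≤ θ)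
    (hchain : IsChain (· ≤ ·) {p | u.1 p = θ ∨ v.1 p = θ}) :
    ∃ u' v' : {x : P → α // IsVertexFilling mark c x},
      (flipGraph mark c).edist u v ≤ (flipGraph mark c).edist u' v' + 1 ∧
        ∀ p, u'.1 p = θ ↔ v'.1 p = θ := by
  by_cases huv : ∀ p, v.1 p = θ → u.1 p = θ
  · obtain ⟨z, hz, hflip, hzv⟩ := u.2.exists_isFlip_of_top v.2 hmin hu hv
      (hchain.mono fun p => Or.inl) huv
    refine ⟨⟨z, hz⟩, v, ?_, hzv⟩
    rw [add_comm]
    exact SimpleGraph.edist_triangle.trans (add_le_add_left (edist_le_one_of_isFlip u.2 hz hflip) _)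
  · have hvu : ∀ p, u.1 p = θ → v.1 p = θ := by
      push Not at huv
      obtain ⟨q, hvq, huq⟩ := huv
      intro p hp
      rcases hchain.total (Or.inl hp) (Or.inr hvq) with h | h
      · exact absurd (le_antisymm (hu q) (hp ▸ u.2.monotone h)) huq
      · exact le_antisymm (hv p) (hvq ▸ v.2.monotone h)
    obtain ⟨z, hz, hflip, hzu⟩ := v.2.exists_isFlip_of_top u.2 hmin hv hu
      (hchain.mono fun p => Or.inr) hvu
    exact ⟨u, ⟨z, hz⟩, SimpleGraph.edist_triangle.trans
      (add_le_add_right (edist_le_one_of_isFlip hz v.2 hflip.symm) _), fun p => (hzu p).symm⟩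

theorem isFlip_of_isChain {x y : P → ℕ} (hx : Monotone x) (hy : Monotone y)
    (hchain : IsChain (· ≤ ·) {p | x p ≠ y p}) (h : ∀ p, x p ≠ y p → x p ≤ 1 ∧ y p ≤ 1) :
    IsFlip x y := by
  have hconst : ∀ p q, x p ≠ y p → x q ≠ y q → x p = x q ∧ y p = y q := by
    intro p q hp hq
    have h1 := h p hp
    have h2 := h q hq
    rcases hchain.total hp hq with hpq | hpq <;> have h3 := hx hpq <;> have h4 := hy hpq <;> omega
  refine ⟨hconst, fun p q => reachable_of_isChain hchain ⟨fun p hp q hq r hr => ?_⟩⟩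
  obtain ⟨hxpq, hypq⟩ := hconst p q hp hq
  have hxr : x r = x p := le_antisymm (hxpq ▸ hx hr.2) (hx hr.1)
  have hyr : y r = y p := le_antisymm (hypq ▸ hy hr.2) (hy hr.1)
  exact hxr.trans_ne (hp.trans_eq hyr.symm)

end Lowering

section Triangle

variable {n : ℕ}

/-- The diagonal cells, which carry the prescribed values of a triangular array. -/
def diagCell (i : Fin n) : TriangleIndex n := ⟨(i, i), le_rfl⟩

/-- The cell in row `i` and column `j`, both counted from `0`. -/
def cell (i j : ℕ) (hi : i < n) (hj : j ≤ i) : TriangleIndex n :=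
  ⟨(⟨i, hi⟩, ⟨j, hj.trans_lt hi⟩), hj⟩

theorem cell_ext {p q : TriangleIndex n} (h₁ : (p.1.1 : ℕ) = q.1.1) (h₂ : (p.1.2 : ℕ) = q.1.2) :
    p = q :=
  Subtype.ext (Prod.ext (Fin.ext h₁) (Fin.ext h₂))

theorem cell_le_iff {p q : TriangleIndex n} :
    p ≤ q ↔ (p.1.1 : ℕ) ≤ q.1.1 ∧ (p.1.2 : ℕ) ≤ q.1.2 :=
  Iff.rfl

theorem cell_covBy_iff {p q : TriangleIndex n} :
    p ⋖ q ↔ ((q.1.1 : ℕ) = p.1.1 + 1 ∧ (q.1.2 : ℕ) = p.1.2) ∨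
      ((q.1.1 : ℕ) = p.1.1 ∧ (q.1.2 : ℕ) = p.1.2 + 1) := by
  have hqn := q.1.1.2
  refine ⟨fun h => ?_, fun h => ⟨lt_iff_le_not_ge.2 ?_, fun r hpr hrq => ?_⟩⟩
  · obtain ⟨h₁, h₂⟩ := cell_le_iff.1 h.le
    have hne : p ≠ q := h.ne
    rcases h₂.lt_or_eq with h₂ | h₂
    · rcases h.eq_or_eq (c := cell q.1.1 (q.1.2 - 1) hqn (by omega))
        (cell_le_iff.2 (by simp only [cell]; omega)) (cell_le_iff.2 (by simp only [cell]; omega))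
        with h | h <;> simp only [Subtype.ext_iff, Prod.ext_iff, Fin.ext_iff, cell] at h <;> omega
    · have h₃ : (p.1.1 : ℕ) ≠ q.1.1 := fun h₃ => hne (cell_ext h₃ h₂)
      rcases h.eq_or_eq (c := cell (q.1.1 - 1) q.1.2 (by omega) (by omega))
        (cell_le_iff.2 (by simp only [cell]; omega)) (cell_le_iff.2 (by simp only [cell]; omega))
        with h | h <;> simp only [Subtype.ext_iff, Prod.ext_iff, Fin.ext_iff, cell] at h <;> omega
  · rw [cell_le_iff, cell_le_iff]
    omega
  · rw [lt_iff_le_not_ge, cell_le_iff, cell_le_iff] at hpr hrq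
    omega

theorem exists_diagCell_of_isMin {p : TriangleIndex n} (hp : IsMin p) : ∃ i, diagCell i = p := by
  let i : Fin n := ⟨0, p.1.1.pos⟩
  have hi : diagCell i ≤ p := cell_le_iff.2 ⟨Nat.zero_le _, Nat.zero_le _⟩
  exact ⟨i, (hp.eq_of_ge hi).symm⟩

theorem gtPolytope_eq_markedOrderPolytope (lam : Fin n → ℕ) :
    gtPolytope lam = markedOrderPolytope diagCell fun i => (lam i : ℝ) := by
  classical
  let _ : LocallyFiniteOrder (TriangleIndex n) := Fintype.toLocallyFiniteOrder
  ext x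
  refine ⟨fun ⟨hdiag, hcol, hrow⟩ => ⟨(monotone_iff_forall_covBy x).2 fun p q hpq => ?_, hdiag⟩,
    fun h => ⟨h.apply_mark, fun p q h₁ h₂ => h.monotone (cell_le_iff.2 ?_),
      fun p q h₁ h₂ => h.monotone (cell_le_iff.2 ?_)⟩⟩
  · rcases cell_covBy_iff.1 hpq with ⟨h₁, h₂⟩ | ⟨h₁, h₂⟩
    · exact hcol p q h₁ (Fin.ext h₂)
    · exact hrow p q (Fin.ext h₁) h₂
  · omega
  · omega

/-- Vertices of a Gelfand–Tsetlin polytope, with the diagonal entries replaced by their levels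
`ℓ 0, ℓ 1, …`; the values of `ℓ` beyond the size of the array are irrelevant. -/
abbrev IsVertexArray (ℓ : ℕ → ℕ) (x : TriangleIndex n → ℕ) : Prop :=
  IsVertexFilling diagCell (fun i : Fin n => ℓ i) x

/-- The vertices of a Gelfand–Tsetlin polytope of size `n` with diagonal levels `ℓ`. -/
abbrev VertexArray (n : ℕ) (ℓ : ℕ → ℕ) : Type :=
  {x : TriangleIndex n → ℕ // IsVertexArray ℓ x}

/-- The 1-skeleton of a Gelfand–Tsetlin polytope of size `n` with diagonal levels `ℓ`. -/
abbrev arrayGraph (n : ℕ) (ℓ : ℕ → ℕ) : SimpleGraph (VertexArray n ℓ) :=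
  flipGraph diagCell fun i : Fin n => ℓ i

variable {ℓ : ℕ → ℕ} {x : TriangleIndex n → ℕ}

theorem IsVertexFilling.apply_le (hx : IsVertexArray ℓ x) (p : TriangleIndex n) : x p ≤ ℓ p.1.1 :=
  (hx.monotone (cell_le_iff.2 ⟨le_rfl, p.2⟩ : p ≤ diagCell p.1.1)).trans_eq (hx.apply_mark _)

theorem IsVertexFilling.le_apply (hx : IsVertexArray ℓ x) (p : TriangleIndex n) : ℓ p.1.2 ≤ x p :=
  (hx.apply_mark _).symm.trans_le
    (hx.monotone (cell_le_iff.2 ⟨p.2, le_rfl⟩ : diagCell p.1.2 ≤ p))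

end Triangle

/-- Weakly increasing sequences `ℓ 0, …, ℓ (n - 1)` that take all the values
`0, …, L`, continued beyond `n - 1` so that the conditions need no bounds on the index. -/
structure IsLevelSeq (n L : ℕ) (ℓ : ℕ → ℕ) : Prop where
  mono : Monotone ℓ
  zero : ℓ 0 = 0
  step : ∀ i, ℓ (i + 1) ≤ ℓ i + 1
  last : ℓ (n - 1) = L

section UpperBound

variable {n : ℕ} {ℓ : ℕ → ℕ} {x : TriangleIndex n → ℕ} {θ : ℕ}

/-- The cells at level `θ` in columns that start, on the diagonal, at a lower level. -/
def unsettled (ℓ : ℕ → ℕ) (x : TriangleIndex n → ℕ) (θ : ℕ) : Set (TriangleIndex n) :=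
  {p | x p = θ ∧ ℓ p.1.2 < θ}

theorem IsVertexFilling.exists_reachable_unsettled (hx : IsVertexArray ℓ x) (hℓ : Monotone ℓ)
    {p : TriangleIndex n} (hp : p ∈ unsettled ℓ x θ) :
    ∃ r ∈ unsettled ℓ x θ, (hasseOn (unsettled ℓ x θ)).Reachable p r ∧ θ ≤ ℓ (r.1.2 + 1) := by
  obtain ⟨i, hi⟩ := hx.exists_reachable p
  have hθi : ℓ i = θ := (hx.apply_mark i).symm.trans ((apply_eq_of_reachable hi rfl).trans hp.1)
  obtain ⟨r, hr, hpr, s, hs, hsp, hrs⟩ :=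
    exists_reachable_covBy_notMem hi hp fun h => h.2.ne hθi
  have hsθ : θ ≤ ℓ s.1.2 := not_lt.1 fun h => hs ⟨Eq.trans hsp hp.1, h⟩
  have hlt : (r.1.2 : ℕ) < s.1.2 := lt_of_not_ge fun h => (hr.2.trans_le hsθ).not_ge (hℓ h)
  have hcol : (s.1.2 : ℕ) = r.1.2 + 1 := by
    rcases hrs with h | h <;> rw [cell_covBy_iff] at h <;> omega
  exact ⟨r, hr, hpr, hcol ▸ hsθ⟩

theorem IsVertexFilling.reachable_unsettled (hx : IsVertexArray ℓ x) (hℓ : Monotone ℓ)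
    {p q : TriangleIndex n} (hp : p ∈ unsettled ℓ x θ) (hq : q ∈ unsettled ℓ x θ) :
    (hasseOn (unsettled ℓ x θ)).Reachable p q := by
  have hcolumn : ∀ r ∈ unsettled ℓ x θ, ∀ s ∈ unsettled ℓ x θ, r ≤ s → (r.1.2 : ℕ) = s.1.2 →
      (hasseOn (unsettled ℓ x θ)).Reachable r s := fun r hr s hs hrs hcol =>
    reachable_of_Icc_subset hrs fun t ht =>
      ⟨le_antisymm (hs.1 ▸ hx.monotone ht.2) (hr.1 ▸ hx.monotone ht.1),
        (hℓ ((cell_le_iff.1 ht.2).2.trans hcol.ge)).trans_lt hr.2⟩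
  obtain ⟨r, hr, hpr, hrθ⟩ := hx.exists_reachable_unsettled hℓ hp
  obtain ⟨s, hs, hqs, hsθ⟩ := hx.exists_reachable_unsettled hℓ hq
  have hrs : ¬(r.1.2 : ℕ) + 1 ≤ s.1.2 := fun h => (hrθ.trans (hℓ h)).not_gt hs.2
  have hsr : ¬(s.1.2 : ℕ) + 1 ≤ r.1.2 := fun h => (hsθ.trans (hℓ h)).not_gt hr.2
  refine hpr.trans (.trans ?_ hqs.symm)
  rcases le_total (r.1.1 : ℕ) s.1.1 with h | h
  · exact hcolumn r hr s hs (cell_le_iff.2 ⟨h, by omega⟩) (by omega)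
  · exact (hcolumn s hs r hr (cell_le_iff.2 ⟨h, by omega⟩) (by omega)).symm

theorem IsVertexFilling.isLowerable_unsettled (hx : IsVertexArray ℓ x) (hℓ : Monotone ℓ) :
    IsLowerable diagCell x θ (unsettled ℓ x θ) where
  apply_eq _ hp := hp.1
  mark_notMem i hi := hi.2.ne ((hx.apply_mark i).symm.trans hi.1)
  mem_of_covBy _ _ hpq hp hq := ⟨hp, (hℓ (cell_le_iff.1 hpq.le).2).trans_lt hq.2⟩
  reachable _ hp _ hq := hx.reachable_unsettled hℓ hp hq
  exists_reachable p hp hpθ := by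
    have hge : θ ≤ ℓ p.1.2 := not_lt.1 fun h => hp ⟨hpθ, h⟩
    have hle : diagCell p.1.2 ≤ p := cell_le_iff.2 ⟨p.2, le_rfl⟩
    refine ⟨p.1.2, (reachable_of_Icc_subset hle fun r hr => ?_).symm⟩
    have hge' : θ ≤ ℓ r.1.2 := hge.trans (hℓ (cell_le_iff.1 hr.1).2)
    exact ⟨le_antisymm (hpθ ▸ hx.monotone hr.2) (hge'.trans (hx.le_apply r)), fun h =>
      h.2.not_ge hge'⟩

theorem IsVertexFilling.exists_isFlip_settled (hx : IsVertexArray ℓ x) (hℓ : Monotone ℓ) (θ : ℕ) :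
    ∃ y, IsVertexArray ℓ y ∧ IsFlip x y ∧ (∀ p, y p = θ → ℓ p.1.2 = θ) ∧
      (∀ p, x p ≠ θ → y p = x p) ∧ ∀ p, y p ≤ x p := by
  obtain ⟨y, hy, hxy, hlt, heq⟩ :=
    (hx.isLowerable_unsettled (θ := θ) hℓ).exists_isFlip hx fun _ => exists_diagCell_of_isMin
  refine ⟨y, hy, hxy, fun p hp => ?_, fun p hp => heq p fun h => hp h.1, fun p => ?_⟩
  · have hpC : p ∉ unsettled ℓ x θ := fun h => (hlt p h).ne hp
    exact le_antisymm (hp ▸ hy.le_apply p) (not_lt.1 fun h => hpC ⟨heq p hpC ▸ hp, h⟩)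
  · by_cases hpC : p ∈ unsettled ℓ x θ
    · exact (hlt p hpC).le.trans_eq hpC.1.symm
    · exact (heq p hpC).le

variable {L : ℕ} {u v : VertexArray n ℓ}

theorem exists_edist_le_settled (hℓ : Monotone ℓ) (u : VertexArray n ℓ)
    (lo d : ℕ) : ∃ v, (arrayGraph n ℓ).edist u v ≤ d ∧
      (∀ p, lo ≤ v.1 p → v.1 p < lo + d → v.1 p = ℓ p.1.2) ∧
        ∀ p, lo + d ≤ u.1 p ∨ lo + d ≤ v.1 p → u.1 p = v.1 p := by
  induction d generalizing lo with
  | zero => exact ⟨u, by simp, fun p h₁ h₂ => absurd h₁ h₂.not_ge, fun _ _ => rfl⟩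
  | succ d ih =>
    obtain ⟨v, huv, hset, heq⟩ := ih (lo + 1)
    obtain ⟨y, hy, hvy, hlo, hne, hle⟩ := v.2.exists_isFlip_settled hℓ lo
    have hyv : ∀ p, lo < y p → y p = v.1 p := fun p hp => hne p (hp.trans_le (hle p)).ne'
    refine ⟨⟨y, hy⟩, ?_, fun p h₁ h₂ => ?_, fun p hp => ?_⟩
    · push_cast
      exact SimpleGraph.edist_triangle.trans (add_le_add huv (edist_le_one_of_isFlip v.2 hy hvy))
    · dsimp only at h₁ h₂ ⊢
      rcases h₁.eq_or_lt with h | h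
      · exact h.symm.trans (hlo p h.symm).symm
      · have hyp := hyv p h
        rw [hyp] at h h₂ ⊢
        exact hset p h (by omega)
    · dsimp only at hp ⊢
      have hp' : lo + 1 + d ≤ v.1 p := by
        rcases hp with h | h
        · have := heq p (.inl (by omega))
          omega
        · have := hle p
          omega
      rw [heq p (.inr hp'), hne p (by omega)]

theorem exists_edist_le_of_agree (hℓ : Monotone ℓ) {lo d : ℕ}
    (huv : ∀ p, lo + d ≤ u.1 p ∨ lo + d ≤ v.1 p → u.1 p = v.1 p) :
    ∃ u' v' : VertexArray n ℓ,
      (arrayGraph n ℓ).edist u v ≤ 2 * d + (arrayGraph n ℓ).edist u' v' ∧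
        ∀ p, u'.1 p ≠ v'.1 p → u'.1 p < lo ∧ v'.1 p < lo := by
  obtain ⟨u', hu, hu', heu⟩ := exists_edist_le_settled hℓ u lo d
  obtain ⟨v', hv, hv', hev⟩ := exists_edist_le_settled hℓ v lo d
  refine ⟨u', v', ?_, fun p hp => ?_⟩
  · calc (arrayGraph n ℓ).edist u v
        ≤ (arrayGraph n ℓ).edist u u' +
            ((arrayGraph n ℓ).edist u' v' + (arrayGraph n ℓ).edist v' v) :=
          SimpleGraph.edist_triangle.trans (add_le_add_right SimpleGraph.edist_triangle _)
      _ ≤ d + ((arrayGraph n ℓ).edist u' v' + d) := by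
          rw [SimpleGraph.edist_comm (u := v')]
          gcongr
      _ = 2 * d + (arrayGraph n ℓ).edist u' v' := by ring
  · have hcol := u'.2.le_apply p
    have hcol' := v'.2.le_apply p
    have := huv p
    have := heu p
    have := hev p
    have := hu' p
    have := hv' p
    omega

theorem edist_le_of_agree (hℓ : Monotone ℓ) {f d : ℕ} (hf : f = if ℓ 1 = 0 then 0 else 1)
    (huv : ∀ p, 1 + f + d ≤ u.1 p ∨ 1 + f + d ≤ v.1 p → u.1 p = v.1 p) :
    (arrayGraph n ℓ).edist u v ≤ (2 * d + f : ℕ) := by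
  obtain ⟨u', v', huv', hlow⟩ := exists_edist_le_of_agree hℓ huv
  refine huv'.trans ?_
  push_cast
  gcongr
  split_ifs at hf with h₁
  · have heq : u' = v' := Subtype.ext (funext fun p => by
      by_contra hp
      have := hlow p hp
      omega)
    simp [heq]
  · have hcol : ∀ p, u'.1 p ≠ v'.1 p → (p.1.2 : ℕ) = 0 := fun p hp => by
      by_contra h
      have := hℓ (Nat.one_le_iff_ne_zero.2 h)
      have := hlow p hp
      have := u'.2.le_apply p
      have := v'.2.le_apply p
      omega
    rw [hf, Nat.cast_one]
    refine edist_le_one_of_isFlip u'.2 v'.2 (isFlip_of_isChain u'.2.monotone v'.2.monotone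
      (fun p hp q hq _ => ?_) fun p hp => ?_)
    · have := hcol p hp
      have := hcol q hq
      change p ≤ q ∨ q ≤ p
      rw [cell_le_iff, cell_le_iff]
      omega
    · have := hlow p hp
      omega

theorem isChain_of_last_row {S : Set (TriangleIndex n)} (hS : ∀ p ∈ S, (p.1.1 : ℕ) + 1 = n) :
    IsChain (· ≤ ·) S := fun p hp q hq _ => by
  have := hS p hp
  have := hS q hq
  change p ≤ q ∨ q ≤ p
  rw [cell_le_iff, cell_le_iff]
  omega

theorem IsLevelSeq.edist_le (hℓ : IsLevelSeq n L ℓ) (hn : 2 ≤ n)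
    (hL : 2 ≤ L ∨ ℓ 1 = 0 ∨ ℓ (n - 2) = L) (u v : VertexArray n ℓ) :
    (arrayGraph n ℓ).edist u v ≤
      (2 * L - (if ℓ 1 = 0 then 0 else 1) - (if ℓ (n - 2) = L then 0 else 1) : ℕ) := by
  obtain ⟨f, hf⟩ : ∃ f, f = if ℓ 1 = 0 then 0 else 1 := ⟨_, rfl⟩
  have hL₁ : ℓ 1 ≤ L := hℓ.last ▸ hℓ.mono (by omega)
  have hle : ∀ w : VertexArray n ℓ, ∀ p, w.1 p ≤ L := fun w p =>
    (w.2.apply_le p).trans (hℓ.last ▸ hℓ.mono (by omega))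
  rw [← hf]
  split_ifs with hlast
  · refine (edist_le_of_agree hℓ.mono (d := L - f) hf fun p hp => ?_).trans ?_
    · have := hle u p
      have := hle v p
      split_ifs at hf <;> omega
    · gcongr
      split_ifs at hf <;> omega
  · have hlast' : ℓ (n - 2) ≤ L := hℓ.last ▸ hℓ.mono (by omega)
    have hrow : ∀ w : VertexArray n ℓ, ∀ p, w.1 p = L →
        (p.1.1 : ℕ) + 1 = n := fun w p hp => by
      by_contra h
      have := hℓ.mono (show (p.1.1 : ℕ) ≤ n - 2 by omega)
      have := w.2.apply_le p
      omega
    obtain ⟨u', v', huv, htop⟩ := exists_edist_le_of_top (fun _ => exists_diagCell_of_isMin)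
      (hle u) (hle v) (isChain_of_last_row fun p hp => hp.elim (hrow u p) (hrow v p))
    have hd := edist_le_of_agree (u := u') (v := v') (d := L - f - 1) hℓ.mono hf fun p hp => by
      have := hle u' p
      have := hle v' p
      have := htop p
      split_ifs at hf <;> omega
    calc (arrayGraph n ℓ).edist u v
        ≤ (2 * (L - f - 1) + f : ℕ) + 1 := huv.trans (add_le_add_left hd 1)
      _ ≤ (2 * L - f - 1 : ℕ) := by
        rw [← Nat.cast_add_one, Nat.cast_le]
        split_ifs at hf <;> omega

end UpperBound

section Changes

variable {P α β : Type*} {X : ℕ → P → α} {N : ℕ}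

open Classical in
/-- The number of changes of a sequence `X 0, …, X N`. -/
noncomputable def changes {γ : Type*} (X : ℕ → γ) (N : ℕ) : ℕ :=
  ((Finset.range N).filter fun t => X t ≠ X (t + 1)).card

theorem changes_le {γ : Type*} (X : ℕ → γ) (N : ℕ) : changes X N ≤ N := by
  classical
  exact (Finset.card_filter_le _ _).trans (Finset.card_range N).le

/-- The times at which some entry of `X` changes from `a` to `b` or from `b` to `a`. -/
def moveTimes (N : ℕ) (X : ℕ → P → α) (a b : α) : Set ℕ :=
  {t | t < N ∧ ∃ p, s(X t p, X (t + 1) p) = s(a, b)}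

theorem exists_switch {Q : ℕ → Prop} {a b : ℕ} (hab : a ≤ b) (ha : ¬Q a) (hb : Q b) :
    ∃ t, a ≤ t ∧ t < b ∧ ¬Q t ∧ Q (t + 1) := by
  induction b, hab using Nat.le_induction with
  | base => exact absurd hb ha
  | succ b hab ih =>
    by_cases h : Q b
    · obtain ⟨t, hat, htb, ht⟩ := ih h
      exact ⟨t, hat, htb.trans b.lt_succ_self, ht⟩
    · exact ⟨b, hab, b.lt_succ_self, h, hb⟩

variable [Preorder P]

theorem sym2_eq_of_mem_moveTimes (hX : ∀ t < N, IsFlip (X t) (X (t + 1))) {t : ℕ} {a b c d : α}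
    (hab : a ≠ b) (hcd : c ≠ d) (h₁ : t ∈ moveTimes N X a b) (h₂ : t ∈ moveTimes N X c d) :
    s(a, b) = s(c, d) := by
  obtain ⟨ht, p, hp⟩ := h₁
  obtain ⟨-, q, hq⟩ := h₂
  have ne {r : P} {a b : α} (hab : a ≠ b) (hr : s(X t r, X (t + 1) r) = s(a, b)) :
      X t r ≠ X (t + 1) r := by
    rwa [Ne, ← Sym2.mk_isDiag_iff, hr, Sym2.mk_isDiag_iff]
  obtain ⟨h₁, h₂⟩ := (hX t ht).const p q (ne hab hp) (ne hcd hq)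
  rw [← hp, ← hq, h₁, h₂]

theorem card_add_changes_comp_le (hX : ∀ t < N, IsFlip (X t) (X (t + 1))) (f : α → β)
    (T : Finset ℕ)
    (hT : ∀ t ∈ T, t < N ∧ ∃ p, X t p ≠ X (t + 1) p ∧ f (X t p) = f (X (t + 1) p)) :
    T.card + changes (fun t => f ∘ X t) N ≤ changes X N := by
  classical
  unfold changes
  rw [← Finset.card_union_of_disjoint]
  · refine Finset.card_le_card fun t ht => ?_
    simp only [Finset.mem_union, Finset.mem_filter, Finset.mem_range] at ht ⊢
    rcases ht with ht | ⟨htN, hne⟩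
    · obtain ⟨htN, p, hne, -⟩ := hT t ht
      exact ⟨htN, fun h => hne (congrFun h p)⟩
    · exact ⟨htN, fun h => hne (by rw [h])⟩
  · refine Finset.disjoint_left.2 fun t ht ht' => ?_
    obtain ⟨htN, p, hne, hf⟩ := hT t ht
    refine (Finset.mem_filter.1 ht').2 (funext fun q => ?_)
    by_cases hq : X t q = X (t + 1) q
    · exact congrArg f hq
    · obtain ⟨h₁, h₂⟩ := (hX t htN).const q p hq hne
      simpa only [Function.comp_apply, h₁, h₂] using hf

end Changes

section Merge

variable {n L k d : ℕ} {ℓ : ℕ → ℕ}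

/-- The monotone map that identifies the levels `k, …, k + d` and closes the resulting gap. -/
def merge (k d t : ℕ) : ℕ := min t k + (t - (k + d))

theorem merge_monotone (k d : ℕ) : Monotone (merge k d) := fun a b h => by
  unfold merge
  omega

theorem IsLevelSeq.merge (hℓ : IsLevelSeq n L ℓ) (hkd : k + d ≤ L) :
    IsLevelSeq n (L - d) (merge k d ∘ ℓ) where
  mono := (merge_monotone k d).comp hℓ.mono
  zero := by simp [GelfandTsetlin.merge, hℓ.zero]
  step i := by
    have := hℓ.step i
    have := hℓ.mono i.le_succ
    simp only [GelfandTsetlin.merge, Function.comp_apply]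
    omega
  last := by
    simp only [GelfandTsetlin.merge, Function.comp_apply, hℓ.last]
    omega

theorem IsLevelSeq.exists_jump (hℓ : IsLevelSeq n L ℓ) (hk : k < L) :
    ∃ s, s + 1 < n ∧ ℓ s = k ∧ ℓ (s + 1) = k + 1 := by
  obtain ⟨s, -, hs, h₁, h₂⟩ := exists_switch (Q := fun i => k < ℓ i) (Nat.zero_le (n - 1))
    (by rw [hℓ.zero]; omega) (by rwa [hℓ.last])
  have := hℓ.step s
  exact ⟨s, by omega, by omega, by omega⟩

end Merge

section Transit

variable {n L N s k t : ℕ} {ℓ : ℕ → ℕ} {X : ℕ → TriangleIndex n → ℕ}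

/-- Walks in the 1-skeleton, possibly resting, from the array with entries `ℓ ⌊(i + j) / 2⌋` to
the one with entries `ℓ ⌈(i + j) / 2⌉`; these two arrays turn out to be at maximal distance. -/
structure IsTransit (n : ℕ) (ℓ : ℕ → ℕ) (N : ℕ) (X : ℕ → TriangleIndex n → ℕ) : Prop where
  isVertexArray : ∀ t ≤ N, IsVertexArray ℓ (X t)
  isFlip : ∀ t < N, IsFlip (X t) (X (t + 1))
  initial : ∀ p, X 0 p = ℓ ((p.1.1 + p.1.2) / 2)
  final : ∀ p, X N p = ℓ ((p.1.1 + p.1.2 + 1) / 2)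

theorem IsTransit.comp (h : IsTransit n ℓ N X) {f : ℕ → ℕ} (hf : Monotone f) :
    IsTransit n (f ∘ ℓ) N (fun t => f ∘ X t) where
  isVertexArray t ht := (h.isVertexArray t ht).comp hf
  isFlip t ht := (h.isFlip t ht).comp f
  initial p := congrArg f (h.initial p)
  final p := congrArg f (h.final p)

theorem IsTransit.apply_le (h : IsTransit n ℓ N X) (hℓ : IsLevelSeq n L ℓ) (ht : t ≤ N)
    (p : TriangleIndex n) : X t p ≤ L :=
  ((h.isVertexArray t ht).apply_le p).trans
    ((hℓ.mono (show (p.1.1 : ℕ) ≤ n - 1 by omega)).trans_eq hℓ.last)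

theorem IsTransit.row_ne_col (h : IsTransit n ℓ N X) (ht : t < N) {p : TriangleIndex n}
    (hp : X t p ≠ X (t + 1) p) : (p.1.1 : ℕ) ≠ p.1.2 := fun h_eq => hp <| by
  rw [(cell_ext rfl h_eq.symm : p = diagCell p.1.1), (h.isVertexArray t ht.le).apply_mark,
    (h.isVertexArray (t + 1) ht).apply_mark]

theorem IsTransit.apply_corner_mem (h : IsTransit n ℓ N X) (hs : s + 1 < n) (hk : ℓ s = k)
    (hk' : ℓ (s + 1) = k + 1) (ht : t ≤ N) :
    X t (cell (s + 1) s hs s.le_succ) = k ∨ X t (cell (s + 1) s hs s.le_succ) = k + 1 := by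
  have := (h.isVertexArray t ht).apply_le (cell (s + 1) s hs s.le_succ)
  have := (h.isVertexArray t ht).le_apply (cell (s + 1) s hs s.le_succ)
  simp only [cell] at *
  omega

theorem IsTransit.initial_cell (h : IsTransit n ℓ N X) {i j : ℕ} (hi : i < n) (hj : j ≤ i)
    (hs : (i + j) / 2 = s) : X 0 (cell i j hi hj) = ℓ s :=
  (h.initial _).trans (congrArg ℓ hs)

theorem IsTransit.final_cell (h : IsTransit n ℓ N X) {i j : ℕ} (hi : i < n) (hj : j ≤ i)
    (hs : (i + j + 1) / 2 = s) : X N (cell i j hi hj) = ℓ s :=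
  (h.final _).trans (congrArg ℓ hs)

theorem IsTransit.exists_corner_switch (h : IsTransit n ℓ N X) (hs : s + 1 < n) (hk : ℓ s = k)
    (hk' : ℓ (s + 1) = k + 1) :
    ∃ τ < N, X τ (cell (s + 1) s hs s.le_succ) = k ∧
      X (τ + 1) (cell (s + 1) s hs s.le_succ) = k + 1 := by
  have h₀ := h.initial_cell (s := s) hs s.le_succ (by omega)
  have h₁ := h.final_cell (s := s + 1) hs s.le_succ (by omega)
  obtain ⟨τ, -, hτ, h₂, h₃⟩ := exists_switch (Nat.zero_le N)
    (Q := fun t => X t (cell (s + 1) s hs s.le_succ) = k + 1) (by omega) (by omega)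
  exact ⟨τ, hτ, (h.apply_corner_mem hs hk hk' hτ.le).resolve_right h₂, h₃⟩

theorem IsTransit.moveTimes_nonempty (h : IsTransit n ℓ N X) (hℓ : IsLevelSeq n L ℓ)
    (hk : k < L) : (moveTimes N X k (k + 1)).Nonempty := by
  obtain ⟨s, hs, h₁, h₂⟩ := hℓ.exists_jump hk
  obtain ⟨τ, hτ, hk, hk'⟩ := h.exists_corner_switch hs h₁ h₂
  exact ⟨τ, hτ, _, by rw [hk, hk']⟩

theorem IsTransit.le_of_mem_moveTimes (h : IsTransit n ℓ N X) (hℓ : IsLevelSeq n L ℓ) {a : ℕ}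
    (ht : t ∈ moveTimes N X a k) : k ≤ L := by
  obtain ⟨ht, p, hp⟩ := ht
  rcases Sym2.eq_iff.1 hp with ⟨-, rfl⟩ | ⟨rfl, -⟩
  · exact h.apply_le hℓ ht p
  · exact h.apply_le hℓ ht.le p

/-- The times of the moves that disappear when the levels `k, …, k + d` are identified. -/
def mergedTimes (N : ℕ) (X : ℕ → TriangleIndex n → ℕ) (k d : ℕ) : Set ℕ :=
  {t | ∃ a ∈ Set.Icc k (k + d), ∃ b ∈ Set.Icc k (k + d), a ≠ b ∧ t ∈ moveTimes N X a b}

theorem IsTransit.card_add_changes_merge_le (h : IsTransit n ℓ N X) {d : ℕ} {T : Finset ℕ}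
    (hT : ↑T ⊆ mergedTimes N X k d) :
    T.card + changes (fun t => merge k d ∘ X t) N ≤ changes X N := by
  refine card_add_changes_comp_le h.isFlip (merge k d) T fun t ht => ?_
  obtain ⟨a, ha, b, hb, hab, ht, p, hp⟩ := hT ht
  rw [Set.mem_Icc] at ha hb
  rw [Sym2.eq_iff] at hp
  exact ⟨ht, p, by omega, by unfold merge; omega⟩

end Transit

section SimpleTransit

variable {n L N s k t u τ τ₀ τ₁ σ : ℕ} {ℓ : ℕ → ℕ} {X : ℕ → TriangleIndex n → ℕ}

/-- The entry `p` stays at the level `k` up to the time `τ` and at `k + 1` from then on. -/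
structure JumpsAt (N : ℕ) (X : ℕ → TriangleIndex n → ℕ) (p : TriangleIndex n) (k τ : ℕ) :
    Prop where
  lt : τ < N
  before : ∀ t ≤ τ, X t p = k
  after : ∀ t, τ < t → t ≤ N → X t p = k + 1

theorem JumpsAt.mem_moveTimes {p : TriangleIndex n} (hp : JumpsAt N X p k τ) :
    τ ∈ moveTimes N X k (k + 1) :=
  ⟨hp.lt, p, by rw [hp.before τ le_rfl, hp.after _ (Nat.lt_add_one τ) hp.lt]⟩

theorem JumpsAt.apply_eq_of_ne {p q : TriangleIndex n} (hp : JumpsAt N X p k τ)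
    (h : IsTransit n ℓ N X) (hq : X τ q ≠ X (τ + 1) q) : X τ q = k ∧ X (τ + 1) q = k + 1 := by
  have h₁ := hp.before τ le_rfl
  have h₂ := hp.after _ (Nat.lt_add_one τ) hp.lt
  have := (h.isFlip τ hp.lt).const p q (by omega) hq
  omega

/-- Transits in which the moves between any two consecutive levels all happen at the same time. -/
structure IsSimpleTransit (n L : ℕ) (ℓ : ℕ → ℕ) (N : ℕ) (X : ℕ → TriangleIndex n → ℕ) : Prop
    extends IsTransit n ℓ N X where
  isLevelSeq : IsLevelSeq n L ℓ
  subsingleton : ∀ k, (moveTimes N X k (k + 1)).Subsingleton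

theorem IsSimpleTransit.eq_of_jumpsAt {p q : TriangleIndex n} (h : IsSimpleTransit n L ℓ N X)
    (hp : JumpsAt N X p k τ) (ht : t < N) (hq : X t q = k) (hq' : X (t + 1) q = k + 1) : t = τ :=
  h.subsingleton k ⟨ht, q, by rw [hq, hq']⟩ hp.mem_moveTimes

theorem IsSimpleTransit.apply_succ_ne {p : TriangleIndex n} (h : IsSimpleTransit n L ℓ N X)
    (ht : t < N) (hp : X t p = k + 1) : X (t + 1) p ≠ k := fun hp' => by
  obtain ⟨s, hs, hk, hk'⟩ := h.isLevelSeq.exists_jump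
    (hp.symm.trans_le (h.apply_le h.isLevelSeq ht.le p))
  obtain ⟨τ, hτ, h₁, h₂⟩ := h.exists_corner_switch hs hk hk'
  obtain rfl : t = τ :=
    h.subsingleton k ⟨ht, p, by rw [hp, hp', Sym2.eq_swap]⟩ ⟨hτ, _, by rw [h₁, h₂]⟩
  have := (h.isFlip t ht).const p (cell (s + 1) s hs s.le_succ) (by omega) (by omega)
  omega

theorem IsSimpleTransit.exists_jumpsAt (h : IsSimpleTransit n L ℓ N X) (hs : s + 1 < n)
    (hk : ℓ s = k) (hk' : ℓ (s + 1) = k + 1) :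
    ∃ τ, JumpsAt N X (cell (s + 1) s hs s.le_succ) k τ := by
  obtain ⟨τ, hτ, h₁, h₂⟩ := h.exists_corner_switch hs hk hk'
  refine ⟨τ, hτ, fun t ht => ?_, fun t ht htN => ?_⟩ <;> by_contra hne
  · obtain ⟨σ, -, hστ, h₃, h₄⟩ := exists_switch
      (Q := fun t => X t (cell (s + 1) s hs s.le_succ) = k) ht hne h₁
    have := (h.apply_corner_mem hs hk hk' (hστ.trans hτ).le).resolve_left h₃
    exact h.apply_succ_ne (hστ.trans hτ) this h₄
  · obtain ⟨σ, -, hσt, h₃, h₄⟩ := exists_switch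
      (Q := fun t => X t (cell (s + 1) s hs s.le_succ) ≠ k + 1) (Nat.succ_le_of_lt ht)
      (not_not.2 h₂) hne
    have := (h.apply_corner_mem hs hk hk' (by omega : σ + 1 ≤ N)).resolve_right h₄
    exact h.apply_succ_ne (by omega) (not_not.1 h₃) this

theorem IsSimpleTransit.left_of_jumpsAt (h : IsSimpleTransit n L ℓ N X) (hu : u + 3 < n)
    (h₁ : ℓ (u + 1) = 0) (h₂ : ℓ (u + 2) = 1)
    (hτ : JumpsAt N X (cell (u + 2) (u + 1) (by omega) (by omega)) 0 τ) :
    X τ (cell (u + 3) u hu (by omega)) = 0 ∧ X (τ + 1) (cell (u + 3) u hu (by omega)) = 1 := by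
  set q : TriangleIndex n := cell (u + 3) u hu (by omega)
  have h_start : X 0 q = ℓ (u + 1) := h.initial_cell _ _ (by omega)
  have h_final : X N q = ℓ (u + 2) := h.final_cell _ _ (by omega)
  obtain ⟨t, -, ht, hne, h_eq⟩ := exists_switch (Q := fun t => X t q = 1) (Nat.zero_le N)
    (by omega) (by omega)
  have h_le : X t q ≤ ℓ (u + 3) := (h.isVertexArray t ht.le).apply_le q
  have h_step : ℓ (u + 3) ≤ ℓ (u + 2) + 1 := h.isLevelSeq.step (u + 2)
  have h_down : X t q ≠ 2 := fun h' => h.apply_succ_ne ht h' h_eq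
  have h_zero : X t q = 0 := by omega
  obtain rfl := h.eq_of_jumpsAt hτ ht h_zero h_eq
  exact ⟨h_zero, h_eq⟩

theorem IsSimpleTransit.apply_succ_of_jumpsAt (h : IsSimpleTransit n L ℓ N X) (hu : u + 2 < n)
    (h₁ : ℓ (u + 1) = 0) (h₂ : ℓ (u + 2) = 1)
    (hτ : JumpsAt N X (cell (u + 2) (u + 1) hu (by omega)) 0 τ) :
    X τ (cell (u + 2) u hu (by omega)) = X (τ + 1) (cell (u + 2) u hu (by omega)) := by
  set b : TriangleIndex n := cell (u + 2) u hu (by omega)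
  by_contra hne
  obtain ⟨-, h_eq⟩ := hτ.apply_eq_of_ne h.toIsTransit hne
  have h_final : X N b = ℓ (u + 1) := h.final_cell _ _ (by omega)
  obtain ⟨t, -, ht, h_one, h_ne⟩ := exists_switch (Q := fun t => X t b ≠ 1)
    (Nat.succ_le_of_lt hτ.lt) (not_not.2 h_eq) (by omega)
  have h_le : X (t + 1) b ≤ ℓ (u + 2) := (h.isVertexArray _ ht).apply_le b
  exact h.apply_succ_ne ht (not_not.1 h_one) (by omega)

/-- The entries `(u + 2, u + 1)` and `(u + 3, u)` jump together, and their connection can only pass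
through `(u + 3, u + 1)`, since `(u + 2, u)` would have to come back to the level `0`. -/
theorem IsSimpleTransit.apply_of_jumpsAt (h : IsSimpleTransit n L ℓ N X) (hu : u + 3 < n)
    (h₁ : ℓ (u + 1) = 0) (h₂ : ℓ (u + 2) = 1)
    (hτ : JumpsAt N X (cell (u + 2) (u + 1) (by omega) (by omega)) 0 τ) :
    X τ (cell (u + 3) (u + 1) hu (by omega)) = 0 ∧
      X (τ + 1) (cell (u + 3) (u + 1) hu (by omega)) = 1 := by
  have h_corner := hτ.before τ le_rfl
  have h_corner' := hτ.after _ (Nat.lt_add_one τ) hτ.lt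
  have h_left := h.left_of_jumpsAt hu h₁ h₂ hτ
  have h_inner := h.apply_succ_of_jumpsAt (by omega) h₁ h₂ hτ
  obtain ⟨z, hz, hzne⟩ := (h.isFlip τ hτ.lt).exists_covBy_ne
    (p := cell (u + 2) (u + 1) (by omega) (by omega)) (q := cell (u + 3) u hu (by omega))
    (by simp [cell]) (by omega) (by omega)
  have h_off := h.row_ne_col hτ.lt hzne
  simp only [cell_covBy_iff, cell] at hz
  rcases hz with (hz | hz) | hz | hz
  · rw [(cell_ext hz.1 hz.2 : z = cell (u + 3) (u + 1) hu (by omega))] at hzne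
    exact hτ.apply_eq_of_ne h.toIsTransit hzne
  · exact absurd (hz.1.trans hz.2.symm) h_off
  · exact absurd (by omega) h_off
  · have hz' : z = cell (u + 2) u (by omega) (by omega) :=
      cell_ext hz.1.symm (Nat.succ_injective hz.2).symm
    rw [hz'] at hzne
    exact absurd h_inner hzne

/-- The entry `(u + 3, u + 1)` starts and ends at the level `1` but is at `0` just before `τ`. -/
theorem IsSimpleTransit.exists_drop (h : IsSimpleTransit n L ℓ N X) (hu : u + 3 < n)
    (h₁ : ℓ (u + 1) = 0) (h₂ : ℓ (u + 2) = 1)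
    (hτ : JumpsAt N X (cell (u + 2) (u + 1) (by omega) (by omega)) 0 τ) :
    ∃ σ < τ, X σ (cell (u + 3) (u + 1) hu (by omega)) = 2 ∧
      X (σ + 1) (cell (u + 3) (u + 1) hu (by omega)) = 0 := by
  obtain ⟨h_zero, -⟩ := h.apply_of_jumpsAt hu h₁ h₂ hτ
  set r : TriangleIndex n := cell (u + 3) (u + 1) hu (by omega)
  have h_start : X 0 r = ℓ (u + 2) := h.initial_cell _ _ (by omega)
  obtain ⟨σ, -, hσ, h_ne, h_eq⟩ := exists_switch (Q := fun t => X t r = 0) (Nat.zero_le τ)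
    (by omega) h_zero
  have hσN := hσ.trans hτ.lt
  have h_le : X σ r ≤ ℓ (u + 3) := (h.isVertexArray σ hσN.le).apply_le r
  have h_step : ℓ (u + 3) ≤ ℓ (u + 2) + 1 := h.isLevelSeq.step (u + 2)
  have h_down : X σ r ≠ 1 := fun h' => h.apply_succ_ne hσN h' h_eq
  exact ⟨σ, hσ, by omega, h_eq⟩

/-- The configuration around a double part `0` of the levels followed by parts `1` and `2` in a
simple transit: the entries next to the jumps from `0` to `1` and from `1` to `2` jump at the times
`τ₀` and `τ₁`, and at some time `σ` between the entry adjacent to both drops from `2` to `0`. -/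
structure IsDropAt (n L : ℕ) (ℓ : ℕ → ℕ) (N : ℕ) (X : ℕ → TriangleIndex n → ℕ) (u τ₀ τ₁ σ : ℕ)
    (hu : u + 4 < n) : Prop extends IsSimpleTransit n L ℓ N X where
  level_one : ℓ (u + 1) = 0
  level_two : ℓ (u + 2) = 1
  level_three : ℓ (u + 3) = 2
  corner₀ : JumpsAt N X (cell (u + 2) (u + 1) (by omega) (by omega)) 0 τ₀
  corner₁ : JumpsAt N X (cell (u + 3) (u + 2) (by omega) (by omega)) 1 τ₁
  lt_drop : τ₁ < σ
  drop_lt : σ < τ₀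
  before_drop : X σ (cell (u + 3) (u + 1) (by omega) (by omega)) = 2
  after_drop : X (σ + 1) (cell (u + 3) (u + 1) (by omega) (by omega)) = 0

theorem IsSimpleTransit.exists_isDropAt (h : IsSimpleTransit n L ℓ N X) (hL : 0 < L)
    (h_first : ℓ 1 = 0) (h_last : ℓ (n - 2) = L) :
    ∃ u τ₀ τ₁ σ, ∃ hu : u + 4 < n, IsDropAt n L ℓ N X u τ₀ τ₁ σ hu := by
  obtain ⟨s, hs, hs₁, hs₂⟩ := h.isLevelSeq.exists_jump hL
  obtain ⟨u, rfl⟩ : ∃ u, s = u + 1 := Nat.exists_eq_succ_of_ne_zero fun hs₀ => by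
    rw [hs₀, zero_add, h_first] at hs₂
    exact absurd hs₂ (by omega)
  have h_lt {i : ℕ} (hi : ℓ i < L) : i < n - 2 := by
    by_contra hle
    have := h.isLevelSeq.mono (not_lt.1 hle)
    omega
  have hu : u + 3 < n := by
    have := h_lt (hs₁.trans_lt hL)
    omega
  obtain ⟨τ₀, hτ₀⟩ := h.exists_jumpsAt hs hs₁ hs₂
  obtain ⟨σ, hσ, h_two, h_zero⟩ := h.exists_drop hu hs₁ hs₂ hτ₀
  have hσN := (hσ.trans hτ₀.lt).le
  have h_le : X σ (cell (u + 3) (u + 1) hu (by omega)) ≤ ℓ (u + 3) :=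
    (h.isVertexArray σ hσN).apply_le _
  have h_leL := h.apply_le h.isLevelSeq hσN (cell (u + 3) (u + 1) hu (by omega))
  have h_step : ℓ (u + 3) ≤ ℓ (u + 2) + 1 := h.isLevelSeq.step (u + 2)
  have hs₂ : ℓ (u + 2) = 1 := hs₂
  have hs₃ : ℓ (u + 3) = 2 := by omega
  have hu' : u + 4 < n := by
    have := h_lt (i := u + 2) (by omega)
    omega
  obtain ⟨τ₁, hτ₁⟩ := h.exists_jumpsAt hu hs₂ hs₃
  refine ⟨u, τ₀, τ₁, σ, hu', h, hs₁, hs₂, hs₃, hτ₀, hτ₁, ?_, hσ, h_two, h_zero⟩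
  by_contra hle
  have h_row : X σ (cell (u + 3) (u + 1) hu (by omega)) ≤
      X σ (cell (u + 3) (u + 2) hu (by omega)) :=
    (h.isVertexArray σ hσN).monotone (cell_le_iff.2 (by simp [cell]))
  have h_corner : X σ (cell (u + 3) (u + 2) hu (by omega)) = 1 := hτ₁.before σ (not_lt.1 hle)
  omega

theorem IsDropAt.drop_mem_moveTimes {hu : u + 4 < n} (h : IsDropAt n L ℓ N X u τ₀ τ₁ σ hu) :
    σ ∈ moveTimes N X 0 2 :=
  ⟨h.drop_lt.trans h.corner₀.lt, cell (u + 3) (u + 1) (by omega) (by omega), by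
    rw [h.before_drop, h.after_drop, Sym2.eq_swap]⟩

theorem IsDropAt.apply_succ_ne_two {hu : u + 4 < n} {p : TriangleIndex n}
    (h : IsDropAt n L ℓ N X u τ₀ τ₁ σ hu) (h₀₂ : (moveTimes N X 0 2).Subsingleton) (ht : t < N)
    (hp : X t p = 0) : X (t + 1) p ≠ 2 := fun hp' => by
  have hr := h.before_drop
  have hr' := h.after_drop
  obtain rfl : t = σ := h₀₂ ⟨ht, p, by rw [hp, hp']⟩ h.drop_mem_moveTimes
  have := (h.isFlip t ht).const p (cell (u + 3) (u + 1) (by omega) (by omega)) (by omega)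
    (by omega)
  omega

theorem IsDropAt.jumpsAt_left {hu : u + 4 < n} (h : IsDropAt n L ℓ N X u τ₀ τ₁ σ hu)
    (h₀₂ : (moveTimes N X 0 2).Subsingleton) :
    JumpsAt N X (cell (u + 3) u (by omega) (by omega)) 0 τ₀ := by
  obtain ⟨-, h_one⟩ := h.left_of_jumpsAt (by omega) h.level_one h.level_two h.corner₀
  set q : TriangleIndex n := cell (u + 3) u (by omega) (by omega)
  have h_start : X 0 q = ℓ (u + 1) := h.initial_cell _ _ (by omega)
  have h_le {t : ℕ} (ht : t ≤ N) : X t q ≤ ℓ (u + 3) := (h.isVertexArray t ht).apply_le q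
  rw [h.level_one] at h_start
  rw [h.level_three] at h_le
  have hτ₀ := h.corner₀.lt
  refine ⟨hτ₀, fun t ht => ?_, fun t ht htN => ?_⟩ <;> by_contra hne
  · obtain ⟨s, -, hst, hs, hs'⟩ := exists_switch (Q := fun t => X t q ≠ 0) (Nat.zero_le t)
      (not_not.2 h_start) hne
    have hsN : s < N := by omega
    have := h_le (t := s + 1) hsN
    have := h.apply_succ_ne_two h₀₂ hsN (not_not.1 hs)
    have := h.eq_of_jumpsAt h.corner₀ hsN (not_not.1 hs) (by omega)
    omega
  · obtain ⟨s, hs_ge, hst, hs, hs'⟩ := exists_switch (Q := fun t => X t q ≠ 1) ht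
      (not_not.2 h_one) hne
    have hsN : s < N := by omega
    have := h_le (t := s + 1) hsN
    have := h.apply_succ_ne hsN (not_not.1 hs)
    have := h.eq_of_jumpsAt h.corner₁ hsN (not_not.1 hs) (by omega)
    have := h.lt_drop
    have := h.drop_lt
    omega

theorem IsDropAt.apply_right_of_gt {hu : u + 4 < n} (h : IsDropAt n L ℓ N X u τ₀ τ₁ σ hu)
    (h₀₂ : (moveTimes N X 0 2).Subsingleton) (ht : τ₁ < t) (htN : t ≤ N) :
    X t (cell (u + 4) (u + 1) hu (by omega)) = 2 := by
  set q : TriangleIndex n := cell (u + 4) (u + 1) hu (by omega)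
  by_contra hne
  have h_final : X N q = ℓ (u + 3) := h.final_cell _ _ (by omega)
  obtain ⟨s, hts, hsN, hs, hs'⟩ := exists_switch (Q := fun t => X t q = 2) htN hne
    (h_final.trans h.level_three)
  have h_le : X s q ≤ ℓ (u + 4) := (h.isVertexArray s hsN.le).apply_le q
  have h_step : ℓ (u + 4) ≤ ℓ (u + 3) + 1 := h.isLevelSeq.step (u + 3)
  have h_level := h.level_three
  have h_three : X s q ≠ 3 := fun h' => h.apply_succ_ne hsN h' hs'
  have h_zero : X s q ≠ 0 := fun h' => h.apply_succ_ne_two h₀₂ hsN h' hs'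
  have := h.eq_of_jumpsAt h.corner₁ hsN (by omega) hs'
  omega

theorem IsDropAt.apply_ne_zero_of_le {hu : u + 4 < n} (h : IsDropAt n L ℓ N X u τ₀ τ₁ σ hu)
    (ht : t ≤ τ₁) : X t (cell (u + 3) (u + 1) (by omega) (by omega)) ≠ 0 := fun h_zero => by
  set r : TriangleIndex n := cell (u + 3) (u + 1) (by omega) (by omega) with hr
  have h_start : X 0 r = ℓ (u + 2) := h.initial_cell _ _ (by omega)
  obtain ⟨s, -, hst, hs, hs'⟩ := exists_switch (Q := fun t => X t r = 0) (Nat.zero_le t)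
    (by rw [h_start, h.level_two]; exact one_ne_zero) h_zero
  have hsN : s < N := by
    have := h.corner₁.lt
    omega
  have h_le : X s r ≤ 1 := h.corner₁.before s (by omega) ▸
    (h.isVertexArray s hsN.le).monotone (cell_le_iff.2 (by simp [hr, cell]))
  exact h.apply_succ_ne hsN (by omega) hs'

theorem IsDropAt.apply_right_of_le {hu : u + 4 < n} (h : IsDropAt n L ℓ N X u τ₀ τ₁ σ hu)
    (h₀₂ : (moveTimes N X 0 2).Subsingleton) (h₁₃ : (moveTimes N X 1 3).Subsingleton)
    (ht : t ≤ τ₁) : X t (cell (u + 4) (u + 1) hu (by omega)) = 1 := by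
  have h_two := h.apply_right_of_gt h₀₂ (Nat.lt_add_one τ₁) h.corner₁.lt
  set q : TriangleIndex n := cell (u + 4) (u + 1) hu (by omega)
  by_contra hne
  have hτ₁ := h.corner₁.lt
  have h_start : X 0 q = ℓ (u + 2) := h.initial_cell _ _ (by omega)
  have h_step : ℓ (u + 4) ≤ ℓ (u + 3) + 1 := h.isLevelSeq.step (u + 3)
  have h_level := h.level_three
  obtain ⟨s, -, hst, hs, hs'⟩ := exists_switch (Q := fun t => X t q ≠ 1) (Nat.zero_le t)
    (not_not.2 (h_start.trans h.level_two)) hne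
  have h_le : X (s + 1) q ≤ ℓ (u + 4) := (h.isVertexArray _ (by omega)).apply_le q
  have h_down : X (s + 1) q ≠ 0 := h.apply_succ_ne (by omega) (not_not.1 hs)
  have h_up : X (s + 1) q ≠ 2 := fun h' => by
    have := h.eq_of_jumpsAt h.corner₁ (by omega) (not_not.1 hs) h'
    omega
  have h_three : X (s + 1) q = 3 := by omega
  obtain ⟨s', hs₁, hs₂, hs₃, hs₄⟩ := exists_switch (Q := fun t => X t q ≠ 3)
    (by omega : s + 1 ≤ τ₁ + 1) (not_not.2 h_three) (by omega)
  have h_le' : X (s' + 1) q ≤ ℓ (u + 4) := (h.isVertexArray _ (by omega)).apply_le q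
  have h_down' : X (s' + 1) q ≠ 2 := h.apply_succ_ne (by omega) (not_not.1 hs₃)
  have hs'τ₁ : s' ≠ τ₁ := fun h' => h_down' (h' ▸ h_two)
  have h_ge : X (s' + 1) (cell (u + 3) (u + 1) (by omega) (by omega)) ≤ X (s' + 1) q :=
    (h.isVertexArray _ (by omega)).monotone (cell_le_iff.2 (by simp [q, cell]))
  have h_pos := h.apply_ne_zero_of_le (t := s' + 1) (by omega)
  have h_one : X (s' + 1) q = 1 := by omega
  have hs_mem : s ∈ moveTimes N X 1 3 := ⟨by omega, q, by rw [not_not.1 hs, h_three]⟩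
  have hs'_mem : s' ∈ moveTimes N X 1 3 :=
    ⟨by omega, q, by rw [not_not.1 hs₃, h_one, Sym2.eq_swap]⟩
  have := h₁₃ hs_mem hs'_mem
  omega

/-- At `τ₀`, the entry `(u + 2, u + 2)` of the diagonal is the only one of level `1`, and it is cut
off from the rest of the array. -/
theorem IsDropAt.apply_outer_ne_one {hu : u + 4 < n} (h : IsDropAt n L ℓ N X u τ₀ τ₁ σ hu) :
    X τ₀ (cell (u + 4) u hu (by omega)) ≠ 1 := fun h_one => by
  set o : TriangleIndex n := cell (u + 4) u hu (by omega)
  obtain ⟨i, hi⟩ := (h.isVertexArray τ₀ h.corner₀.lt.le).exists_reachable o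
  rw [h_one] at hi
  have hℓi : ℓ i = 1 := by
    rw [← (h.isVertexArray τ₀ h.corner₀.lt.le).apply_mark i]
    exact apply_eq_of_reachable hi h_one
  have h_level := h.level_one
  have h_level' := h.level_three
  have hi_lt : (i : ℕ) < u + 3 := by
    by_contra hle
    have := h.isLevelSeq.mono (not_lt.1 hle)
    omega
  have hi_gt : u + 1 < (i : ℕ) := by
    by_contra hle
    have := h.isLevelSeq.mono (not_lt.1 hle)
    omega
  have hi_eq : (i : ℕ) = u + 2 := by omega
  have hne : o ≠ diagCell i := fun h_eq => by
    have h_row : u + 4 = (i : ℕ) := congrArg (fun p : TriangleIndex n => (p.1.1 : ℕ)) h_eq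
    omega
  obtain ⟨z, hz⟩ := hi.nonempty_neighborSet_right hne
  obtain ⟨hz, -, hz_one⟩ := hasseOn_adj.1 hz
  have hz_one : X τ₀ z = 1 := hz_one
  simp only [cell_covBy_iff, diagCell, hi_eq] at hz
  rcases hz with (hz | hz) | hz | hz
  · have h_two := h.corner₁.after τ₀ (h.lt_drop.trans h.drop_lt) h.corner₀.lt.le
    rw [(cell_ext hz.1 hz.2 : z = cell (u + 3) (u + 2) (by omega) (by omega)), h_two] at hz_one
    exact absurd hz_one (by omega)
  · exact absurd z.2 (by rw [not_le, Fin.lt_def]; omega)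
  · exact absurd z.2 (by rw [not_le, Fin.lt_def]; omega)
  · rw [(cell_ext hz.1.symm (Nat.succ_injective hz.2).symm :
        z = cell (u + 2) (u + 1) (by omega) (by omega)), h.corner₀.before τ₀ le_rfl] at hz_one
    exact absurd hz_one zero_ne_one

theorem IsDropAt.apply_outer {hu : u + 4 < n} (h : IsDropAt n L ℓ N X u τ₀ τ₁ σ hu)
    (h₀₂ : (moveTimes N X 0 2).Subsingleton) : X τ₀ (cell (u + 4) u hu (by omega)) = 0 := by
  have hτ₀ := h.corner₀.lt
  have hτ₁ := h.lt_drop.trans h.drop_lt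
  have h_ne := h.apply_outer_ne_one
  set o : TriangleIndex n := cell (u + 4) u hu (by omega)
  have h_ge {t : ℕ} (ht : τ₀ < t) (htN : t ≤ N) : 1 ≤ X t o :=
    ((h.jumpsAt_left h₀₂).after t ht htN).ge.trans
      ((h.isVertexArray t htN).monotone (cell_le_iff.2 (by simp [o, cell])))
  have h_le {t : ℕ} (ht : τ₁ < t) (htN : t ≤ N) : X t o ≤ 2 :=
    h.apply_right_of_gt h₀₂ ht htN ▸
      (h.isVertexArray t htN).monotone (cell_le_iff.2 (by simp [o, cell]))
  have h_final : X N o = ℓ (u + 2) := h.final_cell _ _ (by omega)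
  have h_one : X (τ₀ + 1) o = 1 := by
    by_contra hne
    have h_two : X (τ₀ + 1) o = 2 := by
      have := h_le (hτ₁.trans (Nat.lt_add_one τ₀)) hτ₀
      have := h_ge (Nat.lt_add_one τ₀) hτ₀
      omega
    have h_level := h.level_two
    obtain ⟨s, hs, hsN, hs₁, hs₂⟩ := exists_switch (Q := fun t => X t o < 2) hτ₀
      h_two.not_lt (by omega)
    have h_le_s := h_le (t := s) (by omega) hsN.le
    have h_ge_s := h_ge (t := s + 1) (by omega) hsN
    have h_down : X (s + 1) o ≠ 1 := h.apply_succ_ne hsN (by omega)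
    omega
  exact (h.corner₀.apply_eq_of_ne h.toIsTransit (by omega)).1

theorem IsDropAt.apply_outer_drop {hu : u + 4 < n} (h : IsDropAt n L ℓ N X u τ₀ τ₁ σ hu)
    (h₀₂ : (moveTimes N X 0 2).Subsingleton) :
    X σ (cell (u + 4) u hu (by omega)) = X (σ + 1) (cell (u + 4) u hu (by omega)) := by
  by_contra hne
  have hσN : σ < N := h.drop_lt.trans h.corner₀.lt
  have h_lt := h.lt_drop
  have h_drop_lt := h.drop_lt
  have hr : X σ (cell (u + 3) (u + 1) (by omega) (by omega)) ≠
      X (σ + 1) (cell (u + 3) (u + 1) (by omega) (by omega)) := by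
    rw [h.before_drop, h.after_drop]
    exact two_ne_zero
  obtain ⟨z, hz, hzne⟩ := (h.isFlip σ hσN).exists_covBy_ne
    (p := cell (u + 3) (u + 1) (by omega) (by omega)) (q := cell (u + 4) u hu (by omega))
    (by simp [cell]) hr hne
  simp only [cell_covBy_iff, cell] at hz
  apply hzne
  rcases hz with (hz | hz) | hz | hz
  · rw [(cell_ext hz.1 hz.2 : z = cell (u + 4) (u + 1) hu (by omega)),
      h.apply_right_of_gt h₀₂ h_lt hσN.le, h.apply_right_of_gt h₀₂ (by omega) hσN]
  · rw [(cell_ext hz.1 hz.2 : z = cell (u + 3) (u + 2) (by omega) (by omega)),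
      h.corner₁.after σ h_lt hσN.le, h.corner₁.after (σ + 1) (by omega) hσN]
  · rw [(cell_ext (Nat.succ_injective hz.1).symm hz.2.symm :
        z = cell (u + 2) (u + 1) (by omega) (by omega)),
      h.corner₀.before σ h_drop_lt.le, h.corner₀.before (σ + 1) h_drop_lt]
  · rw [(cell_ext hz.1.symm (Nat.succ_injective hz.2).symm :
        z = cell (u + 3) u (by omega) (by omega)),
      (h.jumpsAt_left h₀₂).before σ h_drop_lt.le, (h.jumpsAt_left h₀₂).before (σ + 1) h_drop_lt]

theorem IsDropAt.not_subsingleton {hu : u + 4 < n} (h : IsDropAt n L ℓ N X u τ₀ τ₁ σ hu)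
    (h₀₂ : (moveTimes N X 0 2).Subsingleton) : ¬(moveTimes N X 1 3).Subsingleton := fun h₁₃ => by
  have h_zero := h.apply_outer h₀₂
  have h_const := h.apply_outer_drop h₀₂
  set o : TriangleIndex n := cell (u + 4) u hu (by omega)
  have h_le {t : ℕ} (ht : t ≤ N) : X t o ≤ 2 := by
    refine ((h.isVertexArray t ht).monotone (cell_le_iff.2 ?_)).trans
      (?_ : X t (cell (u + 4) (u + 1) hu (by omega)) ≤ 2)
    · simp [o, cell]
    · rcases le_or_gt t τ₁ with htτ₁ | htτ₁
      · exact (h.apply_right_of_le h₀₂ h₁₃ htτ₁).trans_le one_le_two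
      · exact (h.apply_right_of_gt h₀₂ htτ₁ ht).le
  have h_start : X 0 o = ℓ (u + 2) := h.initial_cell _ _ (by omega)
  obtain ⟨s, -, hs, hs₁, hs₂⟩ := exists_switch (Q := fun t => X t o = 0) (Nat.zero_le τ₀)
    (by rw [h_start, h.level_two]; exact one_ne_zero) h_zero
  have hsN : s < N := hs.trans h.corner₀.lt
  have h_down : X s o ≠ 1 := fun h' => h.apply_succ_ne hsN h' hs₂
  have h_two : X s o = 2 := by
    have := h_le hsN.le
    omega
  obtain rfl : s = σ := h₀₂ ⟨hsN, o, by rw [h_two, hs₂, Sym2.eq_swap]⟩ h.drop_mem_moveTimes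
  omega

end SimpleTransit

section LowerBound

variable {n L N k : ℕ} {ℓ : ℕ → ℕ} {X : ℕ → TriangleIndex n → ℕ}

theorem IsTransit.exists_subset_mergedTimes_of_not_subsingleton (h : IsTransit n ℓ N X)
    (hℓ : IsLevelSeq n L ℓ) (hk : ¬(moveTimes N X k (k + 2)).Subsingleton) :
    k + 2 ≤ L ∧ ∃ T : Finset ℕ, 2 * 2 ≤ T.card ∧ ↑T ⊆ mergedTimes N X k 2 := by
  obtain ⟨t, ht, t', ht', hne⟩ := Set.not_subsingleton_iff.1 hk
  have hkL := h.le_of_mem_moveTimes hℓ ht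
  obtain ⟨τ, hτ⟩ := h.moveTimes_nonempty hℓ (k := k) (by omega)
  obtain ⟨τ', hτ'⟩ := h.moveTimes_nonempty hℓ (k := k + 1) (by omega)
  have ne_of_mem {a b c d s s' : ℕ} (hs : s ∈ moveTimes N X a b) (hs' : s' ∈ moveTimes N X c d)
      (hab : a ≠ b) (hcd : c ≠ d) (h_ne : s(a, b) ≠ s(c, d)) : s ≠ s' := by
    rintro rfl
    exact h_ne (sym2_eq_of_mem_moveTimes h.isFlip hab hcd hs hs')
  have h_card : ({t, t', τ, τ'} : Finset ℕ).card = 4 := by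
    have hτ_ne {s : ℕ} (hs : s ∈ moveTimes N X k (k + 2)) : s ≠ τ :=
      ne_of_mem hs hτ (by omega) (by omega) (by simp)
    have hτ'_ne {s : ℕ} (hs : s ∈ moveTimes N X k (k + 2)) : s ≠ τ' :=
      ne_of_mem hs hτ' (by omega) (by omega) (by simp)
    have hττ' : τ ≠ τ' := ne_of_mem hτ hτ' (by omega) (by omega) (by simp; omega)
    simp [hne, hτ_ne ht, hτ_ne ht', hτ'_ne ht, hτ'_ne ht', hττ']
  refine ⟨hkL, {t, t', τ, τ'}, h_card.ge, ?_⟩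
  simp only [Finset.coe_insert, Finset.coe_singleton, Set.insert_subset_iff,
    Set.singleton_subset_iff]
  exact ⟨⟨k, by simp, k + 2, by simp, by omega, ht⟩, ⟨k, by simp, k + 2, by simp, by omega, ht'⟩,
    ⟨k, by simp, k + 1, by simp, by omega, hτ⟩, ⟨k + 1, by simp, k + 2, by simp, by omega, hτ'⟩⟩

/-- Were there no such `T`, the transit would be simple and moreover never repeat a move between
the levels `0` and `2` or `1` and `3`. -/
theorem IsTransit.exists_subset_mergedTimes (h : IsTransit n ℓ N X) (hℓ : IsLevelSeq n L ℓ)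
    (hL : 0 < L) (h_first : ℓ 1 = 0) (h_last : ℓ (n - 2) = L) :
    ∃ k d, 0 < d ∧ k + d ≤ L ∧ ∃ T : Finset ℕ, 2 * d ≤ T.card ∧ ↑T ⊆ mergedTimes N X k d := by
  by_contra hT
  have h_one (k : ℕ) : (moveTimes N X k (k + 1)).Subsingleton := fun t ht t' ht' => by
    by_contra hne
    refine hT ⟨k, 1, one_pos, h.le_of_mem_moveTimes hℓ ht, {t, t'}, (Finset.card_pair hne).ge, ?_⟩
    rw [Finset.coe_pair, Set.pair_subset_iff]
    exact ⟨⟨k, by simp, k + 1, by simp, k.succ_ne_self.symm, ht⟩,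
      ⟨k, by simp, k + 1, by simp, k.succ_ne_self.symm, ht'⟩⟩
  have h_two (k : ℕ) : (moveTimes N X k (k + 2)).Subsingleton := by
    by_contra hne
    obtain ⟨hkL, hT'⟩ := h.exists_subset_mergedTimes_of_not_subsingleton hℓ hne
    exact hT ⟨k, 2, two_pos, hkL, hT'⟩
  obtain ⟨u, τ₀, τ₁, σ, hu, h_drop⟩ :=
    IsSimpleTransit.exists_isDropAt ⟨h, hℓ, h_one⟩ hL h_first h_last
  exact h_drop.not_subsingleton (h_two 0) (h_two 1)

theorem IsTransit.two_mul_le_changes (h : IsTransit n ℓ N X) (hℓ : IsLevelSeq n L ℓ)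
    (h_first : ℓ 1 = 0) (h_last : ℓ (n - 2) = L) : 2 * L ≤ changes X N := by
  induction L using Nat.strong_induction_on generalizing ℓ X with
  | _ L ih =>
    rcases L.eq_zero_or_pos with rfl | hL
    · exact Nat.zero_le _
    obtain ⟨k, d, hd, hkd, T, h_card, hT⟩ := h.exists_subset_mergedTimes hℓ hL h_first h_last
    have h_changes := h.card_add_changes_merge_le hT
    have := ih (L - d) (by omega) (h.comp (merge_monotone k d)) (hℓ.merge hkd)
      (by simp [merge, h_first])
      (by simp only [merge, Function.comp_apply, h_last]; omega)
    omega

theorem IsTransit.one_add_changes_merge_le (h : IsTransit n ℓ N X) (hℓ : IsLevelSeq n L ℓ)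
    (hk : k < L) : 1 + changes (fun t => merge k 1 ∘ X t) N ≤ changes X N := by
  obtain ⟨t, ht⟩ := h.moveTimes_nonempty hℓ hk
  refine h.card_add_changes_merge_le (T := {t}) ?_
  rw [Finset.coe_singleton, Set.singleton_subset_iff]
  exact ⟨k, by simp, k + 1, by simp, k.succ_ne_self.symm, ht⟩

theorem IsLevelSeq.le_add_one (hℓ : IsLevelSeq n L ℓ) : L ≤ ℓ (n - 2) + 1 := by
  have h_le := hℓ.mono (by omega : n - 1 ≤ n - 2 + 1)
  have h_step := hℓ.step (n - 2)
  have h_last := hℓ.last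
  omega

theorem IsTransit.sub_le_changes (h : IsTransit n ℓ N X) (hℓ : IsLevelSeq n L ℓ)
    (h_first : ℓ 1 = 0) : 2 * L - (if ℓ (n - 2) = L then 0 else 1) ≤ changes X N := by
  split_ifs with h_last
  · exact h.two_mul_le_changes hℓ h_first h_last
  · rcases L.eq_zero_or_pos with rfl | hL
    · exact Nat.zero_le _
    have h_le : ℓ (n - 2) ≤ L := (hℓ.mono (by omega)).trans_eq hℓ.last
    have h_ge := hℓ.le_add_one
    have h_merge := h.one_add_changes_merge_le hℓ (k := L - 1) (by omega)
    have := (h.comp (merge_monotone (L - 1) 1)).two_mul_le_changes (hℓ.merge (by omega))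
      (by simp [merge, h_first]) (by simp only [merge, Function.comp_apply]; omega)
    omega

theorem IsTransit.le_changes (h : IsTransit n ℓ N X) (hℓ : IsLevelSeq n L ℓ)
    (hL : 2 ≤ L ∨ ℓ 1 = 0 ∨ ℓ (n - 2) = L) :
    2 * L - (if ℓ 1 = 0 then 0 else 1) - (if ℓ (n - 2) = L then 0 else 1) ≤ changes X N := by
  rcases L.eq_zero_or_pos with rfl | hL₀
  · omega
  by_cases h_first : ℓ 1 = 0
  · simpa only [if_pos h_first, Nat.sub_zero] using h.sub_le_changes hℓ h_first
  · have h_one : ℓ 1 ≤ ℓ 0 + 1 := hℓ.step 0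
    have h_zero := hℓ.zero
    have h_ge := hℓ.le_add_one
    have h_last_iff : (merge 0 1 ∘ ℓ) (n - 2) = L - 1 ↔ ℓ (n - 2) = L := by
      simp only [merge, Function.comp_apply]
      omega
    have h_merge := h.one_add_changes_merge_le hℓ hL₀
    have := (h.comp (merge_monotone 0 1)).sub_le_changes (hℓ.merge (by omega))
      (by simp only [merge, Function.comp_apply]; omega)
    simp only [h_last_iff] at this
    rw [if_neg h_first]
    omega

variable {e : ℕ}

theorem exists_covBy_div_eq {p : TriangleIndex n} (hp : (p.1.2 : ℕ) < p.1.1) :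
    ∃ q : TriangleIndex n, (p ⋖ q ∨ q ⋖ p) ∧ (q.1.1 - q.1.2 : ℕ) < p.1.1 - p.1.2 ∧
      ((q.1.1 + q.1.2 + e) / 2 : ℕ) = (p.1.1 + p.1.2 + e) / 2 := by
  simp only [cell_covBy_iff]
  obtain ⟨c, hc | hc⟩ := Nat.even_or_odd' (p.1.1 + p.1.2 + e : ℕ)
  · refine ⟨cell p.1.1 (p.1.2 + 1) p.1.1.2 hp, .inl (.inr ⟨rfl, rfl⟩), ?_, ?_⟩ <;>
      simp only [cell] <;> omega
  · refine ⟨cell (p.1.1 - 1) p.1.2 (by omega) (by omega), .inr (.inl ⟨?_, rfl⟩), ?_, ?_⟩ <;>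
      simp only [cell] <;> omega

theorem exists_reachable_diagCell (p : TriangleIndex n) :
    ∃ i, (hasseOn {q : TriangleIndex n |
      ((q.1.1 + q.1.2 + e) / 2 : ℕ) = (p.1.1 + p.1.2 + e) / 2}).Reachable p (diagCell i) := by
  induction hd : (p.1.1 - p.1.2 : ℕ) using Nat.strong_induction_on generalizing p with
  | _ d ih =>
    rcases (show (p.1.2 : ℕ) ≤ p.1.1 from p.2).lt_or_eq with hp | hp
    · obtain ⟨q, hpq, h_lt, h_eq⟩ := exists_covBy_div_eq (e := e) hp
      obtain ⟨i, hi⟩ := ih _ (hd ▸ h_lt) q rfl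
      rw [h_eq] at hi
      exact ⟨i, .trans (SimpleGraph.Adj.reachable (hasseOn_adj.2 ⟨hpq, Eq.refl _, h_eq⟩)) hi⟩
    · exact ⟨p.1.1, (cell_ext rfl hp : p = diagCell p.1.1) ▸ .rfl⟩

theorem isVertexArray_apply_div (hℓ : Monotone ℓ) (he : e ≤ 1) :
    IsVertexArray ℓ fun p : TriangleIndex n => ℓ ((p.1.1 + p.1.2 + e) / 2) where
  monotone p q hpq := by
    have := cell_le_iff.1 hpq
    exact hℓ (by omega)
  apply_mark i := congrArg ℓ (by simp only [diagCell]; omega)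
  exists_reachable p := by
    obtain ⟨i, hi⟩ := exists_reachable_diagCell (e := e) p
    exact ⟨i, hi.mono (hasseOn_mono fun q hq => congrArg ℓ hq)⟩

theorem IsLevelSeq.exists_le_edist (hℓ : IsLevelSeq n L ℓ)
    (hL : 2 ≤ L ∨ ℓ 1 = 0 ∨ ℓ (n - 2) = L) :
    ∃ u v, ((2 * L - (if ℓ 1 = 0 then 0 else 1) - (if ℓ (n - 2) = L then 0 else 1) : ℕ) : ℕ∞) ≤
      (arrayGraph n ℓ).edist u v := by
  refine ⟨⟨_, isVertexArray_apply_div hℓ.mono zero_le_one⟩,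
    ⟨_, isVertexArray_apply_div hℓ.mono le_rfl⟩, le_iInf fun w => ?_⟩
  have h : IsTransit n ℓ w.length fun t => (w.getVert t).1 :=
    { isVertexArray := fun t _ => (w.getVert t).2
      isFlip := fun t ht => (w.adj_getVert_succ ht).2
      initial := fun p => by rw [w.getVert_zero]; rfl
      final := fun p => by rw [w.getVert_length] }
  exact_mod_cast (h.le_changes hℓ hL).trans (changes_le _ _)

theorem IsLevelSeq.ediam_eq {n L : ℕ} {ℓ : ℕ → ℕ} (hℓ : IsLevelSeq n L ℓ) (hn : 2 ≤ n)
    (hL : 2 ≤ L ∨ ℓ 1 = 0 ∨ ℓ (n - 2) = L) :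
    (arrayGraph n ℓ).ediam =
      (2 * L - (if ℓ 1 = 0 then 0 else 1) - (if ℓ (n - 2) = L then 0 else 1) : ℕ) := by
  obtain ⟨u, v, huv⟩ := hℓ.exists_le_edist hL
  exact le_antisymm (SimpleGraph.ediam_le_of_edist_le (hℓ.edist_le hn hL))
    (huv.trans SimpleGraph.edist_le_ediam)

theorem IsLevelSeq.connected {n L : ℕ} {ℓ : ℕ → ℕ} (hℓ : IsLevelSeq n L ℓ) (hn : 2 ≤ n)
    (hL : 2 ≤ L ∨ ℓ 1 = 0 ∨ ℓ (n - 2) = L) : (arrayGraph n ℓ).Connected := by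
  obtain ⟨u, -⟩ := hℓ.exists_le_edist hL
  have : Nonempty (VertexArray n ℓ) := ⟨u⟩
  refine SimpleGraph.connected_of_ediam_ne_top ?_
  rw [hℓ.ediam_eq hn hL]
  exact ENat.natCast_ne_top _

end LowerBound

section BlockSeq

variable {m : ℕ}

/-- The position at which block `i` begins when blocks of sizes `a 0, a 1, …` are concatenated. -/
def blockStart (a : Fin m → ℕ) (i : ℕ) : ℕ :=
  ∑ j ∈ Finset.range i, if h : j < m then a ⟨j, h⟩ else 0

/-- The index of the block that contains position `k`. Positions beyond the end are counted to the
last block, so that consecutive positions never skip a block. -/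
def blockIndex (a : Fin m → ℕ) (k : ℕ) : ℕ :=
  if h : k < ∑ i, a i then ((finSigmaFinEquiv (n := a)).symm ⟨k, h⟩).1 else m - 1

variable (a : Fin m → ℕ)

theorem blockStart_zero : blockStart a 0 = 0 :=
  Finset.sum_range_zero _

theorem blockStart_succ {i : ℕ} (hi : i < m) :
    blockStart a (i + 1) = blockStart a i + a ⟨i, hi⟩ := by
  rw [blockStart, Finset.sum_range_succ, dif_pos hi, blockStart]

theorem blockStart_eq_sum : blockStart a m = ∑ i, a i := by
  simp [blockStart, Finset.sum_range]

theorem blockStart_mono : Monotone (blockStart a) := fun _ _ h =>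
  Finset.sum_le_sum_of_subset (Finset.range_mono h)

theorem finSigmaFinEquiv_mem_Ico (s : (i : Fin m) × Fin (a i)) :
    (finSigmaFinEquiv s : ℕ) ∈ Set.Ico (blockStart a s.1) (blockStart a (s.1 + 1)) := by
  have h : (finSigmaFinEquiv s : ℕ) = blockStart a s.1 + s.2 := by
    rw [finSigmaFinEquiv_apply, blockStart, Finset.sum_range]
    congr 1
    exact Finset.sum_congr rfl fun j _ => by rw [dif_pos (j.2.trans s.1.2)]; rfl
  have := s.2.2
  rw [Set.mem_Ico, blockStart_succ a s.1.2, h, Fin.eta]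
  omega

theorem blockIndex_lt (hm : 0 < m) (k : ℕ) : blockIndex a k < m := by
  rw [blockIndex]
  split
  · exact Fin.is_lt _
  · omega

theorem le_blockIndex_iff {i : ℕ} (hi : i < m) (k : ℕ) :
    i ≤ blockIndex a k ↔ blockStart a i ≤ k := by
  by_cases hk : k < ∑ j, a j
  · obtain ⟨h₁, h₂⟩ := finSigmaFinEquiv_mem_Ico a (finSigmaFinEquiv.symm ⟨k, hk⟩)
    rw [Equiv.apply_symm_apply] at h₁ h₂
    rw [blockIndex, dif_pos hk]
    refine ⟨fun h => (blockStart_mono a h).trans h₁, fun h => ?_⟩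
    by_contra! hlt
    exact (h₂.trans_le (blockStart_mono a hlt)).not_ge h
  · have h := (blockStart_mono a hi.le).trans_eq (blockStart_eq_sum a)
    rw [blockIndex, dif_neg hk]
    omega

variable {a}

theorem blockStart_pred_add (hm : 0 < m) :
    blockStart a (m - 1) + a ⟨m - 1, Nat.sub_one_lt_of_lt hm⟩ = ∑ i, a i := by
  rw [← blockStart_succ, Nat.sub_add_cancel hm, blockStart_eq_sum]

theorem isLevelSeq_blockIndex (hm : 0 < m) (ha : ∀ i, 0 < a i) :
    IsLevelSeq (∑ i, a i) (m - 1) (blockIndex a) where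
  mono k k' hk := (le_blockIndex_iff a (blockIndex_lt a hm k) k').2
    (((le_blockIndex_iff a (blockIndex_lt a hm k) k).1 le_rfl).trans hk)
  zero := by
    by_contra! h
    have hlt := blockIndex_lt a hm 0
    have h₁ := (le_blockIndex_iff a (i := 0 + 1) (by omega) 0).1 (by omega)
    rw [blockStart_succ a hm] at h₁
    have := ha ⟨0, hm⟩
    omega
  step k := by
    obtain ⟨i, hi⟩ | h₀ : (∃ i, blockIndex a (k + 1) = i + 1) ∨ blockIndex a (k + 1) = 0 := by
      cases blockIndex a (k + 1) <;> simp
    · have hlt := blockIndex_lt a hm (k + 1)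
      have h₁ := (le_blockIndex_iff a (i := i + 1) (by omega) (k + 1)).1 hi.ge
      have := ha ⟨i, by omega⟩
      rw [blockStart_succ a (by omega)] at h₁
      have := (le_blockIndex_iff a (i := i) (by omega) k).2 (by omega)
      omega
    · omega
  last := by
    refine le_antisymm (Nat.le_sub_one_of_lt (blockIndex_lt a hm _)) ?_
    rw [le_blockIndex_iff a (by omega)]
    have := ha ⟨m - 1, Nat.sub_one_lt_of_lt hm⟩
    have := blockStart_pred_add (a := a) hm
    omega

theorem blockIndex_one_eq_zero_iff (hm : 0 < m) (ha : ∀ i, 0 < a i) (hn : 2 ≤ ∑ i, a i) :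
    blockIndex a 1 = 0 ↔ a ⟨0, hm⟩ ≠ 1 := by
  have h₁ : blockStart a 1 = a ⟨0, hm⟩ := by
    simpa [blockStart_zero] using blockStart_succ a hm
  have := ha ⟨0, hm⟩
  rcases Nat.lt_or_ge 1 m with hm₁ | hm₁
  · have := le_blockIndex_iff a hm₁ 1
    omega
  · obtain rfl : m = 1 := by omega
    have := blockIndex_lt a hm 1
    rw [← blockStart_eq_sum] at hn
    omega

theorem blockIndex_sub_two_eq_iff (hm : 0 < m) (ha : ∀ i, 0 < a i) (hn : 2 ≤ ∑ i, a i) :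
    blockIndex a (∑ i, a i - 2) = m - 1 ↔ a ⟨m - 1, Nat.sub_one_lt_of_lt hm⟩ ≠ 1 := by
  have := le_blockIndex_iff a (Nat.sub_one_lt_of_lt hm) (∑ i, a i - 2)
  have := blockIndex_lt a hm (∑ i, a i - 2)
  have := blockStart_pred_add (a := a) hm
  have := ha ⟨m - 1, Nat.sub_one_lt_of_lt hm⟩
  omega

theorem two_le_sum (ha : ∀ i, 0 < a i) (h : 3 ≤ m ∨ ∃ i, a i ≠ 1) : 2 ≤ ∑ i, a i := by
  rcases h with h | ⟨i, hi⟩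
  · have : m ≤ ∑ i, a i := by
      simpa using Finset.sum_le_sum (f := fun _ => 1) (g := a) fun i (_ : i ∈ Finset.univ) => ha i
    omega
  · have := Finset.single_le_sum_of_canonicallyOrdered (f := a) (Finset.mem_univ i)
    have := ha i
    omega

theorem two_le_or_ne_one (hm : 0 < m) (h : 3 ≤ m ∨ ∃ i, a i ≠ 1) :
    2 ≤ m - 1 ∨ a ⟨0, hm⟩ ≠ 1 ∨ a ⟨m - 1, Nat.sub_one_lt_of_lt hm⟩ ≠ 1 := by
  by_contra! hcon
  obtain ⟨hm₂, h₀, h₁⟩ := hcon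
  rcases h with h | ⟨i, hi⟩
  · omega
  · rcases (by omega : (i : ℕ) = 0 ∨ (i : ℕ) = m - 1) with hi' | hi'
    · exact hi ((congrArg a (Fin.ext hi')).trans h₀)
    · exact hi ((congrArg a (Fin.ext hi')).trans h₁)

variable (a) in
theorem nonempty_oneSkeleton_iso_arrayGraph {c : Fin m → ℕ} (hc : StrictMono c) :
    Nonempty (oneSkeleton (gtPolytope (blockSeq c a)) ≃g
      arrayGraph (∑ i, a i) (blockIndex a)) := by
  let block : Fin (∑ i, a i) → Fin m := fun k => (finSigmaFinEquiv.symm k).1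
  let f : Fin m ↪o ℝ := OrderEmbedding.ofStrictMono (fun i => (c i : ℝ))
    (Nat.strictMono_cast.comp hc)
  have hpolytope : gtPolytope (blockSeq c a) = markedOrderPolytope diagCell (f ∘ block) :=
    gtPolytope_eq_markedOrderPolytope _
  have hblock : (fun k : Fin (∑ i, a i) => blockIndex a k) = Fin.valOrderEmb m ∘ block :=
    funext fun k => dif_pos k.2
  rw [hpolytope]
  unfold arrayGraph VertexArray IsVertexArray
  rw [hblock]
  exact ⟨(skeletonIso _ _).trans ((relabelIso _ _ f).symm.trans (relabelIso _ _ _))⟩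

end BlockSeq

end GelfandTsetlin

open GelfandTsetlin in
theorem theorem1p1 (m : ℕ) (hm : 0 < m)
    -- the distinct parts and their multiplicities
    (c a : Fin m → ℕ) (hc : StrictMono c) (hc_pos : ∀ i, 0 < c i) (ha : ∀ i, 0 < a i)
    -- `a` is neither `(1)` nor `(1, 1)`
    (h_small : 3 ≤ m ∨ ∃ i, a i ≠ 1) :
    (oneSkeleton (gtPolytope (blockSeq c a))).Connected ∧
      (oneSkeleton (gtPolytope (blockSeq c a))).ediam ≠ ⊤ ∧
      ((oneSkeleton (gtPolytope (blockSeq c a))).diam : ℤ) =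
        2 * (m : ℤ) - 2 - (if a ⟨0, hm⟩ = 1 then 1 else 0)
          - (if a ⟨m - 1, Nat.sub_one_lt_of_lt hm⟩ = 1 then 1 else 0) := by
  have hn := two_le_sum ha h_small
  have hends := two_le_or_ne_one hm h_small
  have hfirst := blockIndex_one_eq_zero_iff hm ha hn
  have hlast := blockIndex_sub_two_eq_iff hm ha hn
  have hℓ := isLevelSeq_blockIndex hm ha
  rw [← hfirst, ← hlast] at hends
  obtain ⟨φ⟩ := nonempty_oneSkeleton_iso_arrayGraph a hc
  have hediam := (ediam_eq_of_iso φ).trans (hℓ.ediam_eq hn hends)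
  refine ⟨φ.connected_iff.2 (hℓ.connected hn hends), hediam ▸ ENat.natCast_ne_top _, ?_⟩
  rw [SimpleGraph.diam, hediam, ENat.toNat_natCast]
  simp only [hfirst, hlast, ite_not] at hends ⊢
  obtain rfl | hm₂ : m = 1 ∨ 2 ≤ m := by omega
  · have h : a 0 ≠ 1 := by simpa using hends
    simp [h]
  · split_ifs <;> omega
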